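/- **Notation.** $\mathbb H$ is the skew field of real quaternions and $\mathbf B^*$ is the conjugate transpose of $\mathbf B$. $\mathbb H^{m\times n}_r$ is the set of $m\times n$ quaternion matrices of rank $r$, the rank $\operatorname{rk}$ being the dimension of the left row space (equivalently, of the right column space). For a square matrix $\mathbf B$, $\operatorname{Ind}\mathbf B$ is the smallest positive integer $k$ with $\operatorname{rk}\mathbf B^{k+1}=\operatorname{rk}\mathbf B^{k}$. Write $\mathbf b_{i.}$ for the $i$-th row and $\mathbf b_{.j}$ for the $j$-th column of $\mathbf B$. *Row and column determinants.* For $\mathbf B=(b_{ij})\in\mathbb H^{N\times N}$, $\sigma\in S_N$ and $s\in\{1,\dots,N\}$ let $c_\sigma(s)=b_{s\,\sigma(s)}\,b_{\sigma(s)\,\sigma^2(s)}\cdots b_{\sigma^{l}(s)\,s}$, where $l+1$ is the length of the cycle of $\sigma$ through $s$. Let $\rho(\sigma)$ be the number of cycles of $\sigma$ (fixed points included), and let $s_2<\dots<s_{\rho(\sigma)}$ be the least elements of the cycles of $\sigma$ not containing $i$. Then $$\operatorname{rdet}_i\mathbf B=\sum_{\sigma\in S_N}(-1)^{N-\rho(\sigma)}\,c_\sigma(i)\,c_\sigma(s_2)\cdots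 c_\sigma(s_{\rho(\sigma)}),\qquad \operatorname{cdet}_i\mathbf B=\sum_{\sigma\in S_N}(-1)^{N-\rho(\sigma)}\,c_\sigma(s_{\rho(\sigma)})\cdots c_\sigma(s_2)\,c_\sigma(i).$$ For a Hermitian matrix $\mathbf B$ all $\operatorname{rdet}_i\mathbf B$ and $\operatorname{cdet}_i\mathbf B$ coincide and are real; the common value is $|\mathbf B|$, and the determinant of the empty matrix is $1$. *Sums of minors.* $\mathbf B_\alpha^\alpha$ is the principal submatrix of $\mathbf B\in\mathbb H^{N\times N}$ with rows and columns in $\alpha\subseteq\{1,\dots,N\}$; its rows and columns keep their labels from $\alpha$. $I_{q,N}=J_{q,N}$ is the set of $q$-element subsets of $\{1,\dots,N\}$, and $I_{q,N}\{j\}=J_{q,N}\{j\}$ is the set of those that contain $j$ (an empty sum is $0$). $\mathbf B_{j.}(\mathbf b)$ is $\mathbf B$ with its $j$-th row replaced by $\mathbf b$, and $\mathbf B_{.i}(\mathbf c)$ is $\mathbf B$ with its $i$-th column replaced by $\mathbf c$. Put $$R^{q}_{j}(\mathbf B;\mathbf b)=\sum_{\alpha\in I_{q,N}\{j\}}\operatorname{rdet}_j\big(\mathbf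 B_{j.}(\mathbf b)\big)_\alpha^\alpha,\qquad C^{q}_{i}(\mathbf B;\mathbf c)=\sum_{\beta\in J_{q,N}\{i\}}\operatorname{cdet}_i\big(\mathbf B_{.i}(\mathbf c)\big)_\beta^\beta,$$ and, for Hermitian $\mathbf B$, $d_q(\mathbf B)=\sum_{\alpha\in I_{q,N}}|\mathbf B_\alpha^\alpha|$. *Generalized inverses.* $\mathbf A^\dagger$ is the Moore–Penrose inverse of $\mathbf A$, i.e. the unique $\mathbf X$ with $\mathbf{AXA}=\mathbf A$, $\mathbf{XAX}=\mathbf X$, $(\mathbf{AX})^*=\mathbf{AX}$, $(\mathbf{XA})^*=\mathbf{XA}$. For $\mathbf A\in\mathbb H^{m\times n}$ and $\mathbf W\in\mathbb H^{n\times m}$, the $\mathbf W$-weighted Drazin inverse $\mathbf A^{d,W}$ is the unique $\mathbf X\in\mathbb H^{m\times n}$ with $(\mathbf{AW})^{p+1}\mathbf{XW}=(\mathbf{AW})^{p}$ for $p=\operatorname{Ind}(\mathbf{AW})$, $\mathbf{XWAWX}=\mathbf X$ and $\mathbf{AWX}=\mathbf{XWA}$. The weighted CMP inverse is $$\mathbf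 A^{c,\dagger,W}=\mathbf A^\dagger\mathbf A\mathbf W\mathbf A^{d,W}\mathbf W\mathbf A\mathbf A^\dagger .$$ **Theorem 5.3.** Let $\mathbf A\in\mathbb H^{m\times n}_r$, let $\mathbf W\in\mathbb H^{n\times m}$ be nonzero, and put $\mathbf U=\mathbf{WA}$, $\mathbf V=\mathbf{AW}$, $k=\max\{\operatorname{Ind}\mathbf U,\operatorname{Ind}\mathbf V\}$. Then the entries of $\mathbf A^{c,\dagger,W}=(a^{c,\dagger,W}_{ij})\in\mathbb H^{n\times m}$ have the following representations. (i) If $\operatorname{rk}\mathbf U^k=r_1$, then for all $i=1,\dots,n$ and $j=1,\dots,m$ $$a^{c,\dagger,W}_{ij}=\frac{R^{r}_{j}\big(\mathbf{AA}^*;\widetilde{\boldsymbol\omega}_{i.}\big)}{\big(d_r(\mathbf A^*\mathbf A)\big)^2\,\big(d_{r_1}(\mathbf G)\big)^2},\qquad \mathbf G=\mathbf U^{2k+1}(\mathbf U^{2k+1})^*,$$ where $\widetilde{\boldsymbol\omega}_{i.}$ is the $i$-th row of $\widetilde{\boldsymbol\Omega}=\boldsymbol\Omega(\mathbf{WA})^{k+1}\mathbf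 A^*$ and - $\boldsymbol\Omega=(\omega_{iz})\in\mathbb H^{n\times n}$, $\omega_{iz}=C^{r}_{i}(\mathbf A^*\mathbf A;\boldsymbol\phi^{(1)}_{.z})$, with $\boldsymbol\phi^{(1)}_{.z}$ the $z$-th column of $\boldsymbol\Phi_1=\mathbf A^*\mathbf{AW}\widehat{\boldsymbol\Phi}$; - $\widehat{\boldsymbol\Phi}=(\widehat\phi_{tz})\in\mathbb H^{m\times n}$, $\widehat\phi_{tz}=R^{r_1}_{z}(\mathbf G;\widetilde{\boldsymbol\phi}_{t.})$, with $\widetilde{\boldsymbol\phi}_{t.}$ the $t$-th row of $\widetilde{\boldsymbol\Phi}=\mathbf A\boldsymbol\Phi\mathbf U^{2k}(\mathbf U^{2k+1})^*$; - $\boldsymbol\Phi=(\phi_{lq})\in\mathbb H^{n\times n}$, $\phi_{lq}=R^{r_1}_{q}(\mathbf G;\check{\mathbf u}_{l.})$, with $\check{\mathbf u}_{l.}$ the $l$-th row of $\check{\mathbf U}=\mathbf U^{k}(\mathbf U^{2k+1})^*$. (ii) If $\operatorname{rk}\mathbf V^k=r_1$, then for all $i=1,\dots,n$ and $j=1,\dots,m$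 $$a^{c,\dagger,W}_{ij}=\frac{C^{r}_{i}\big(\mathbf A^*\mathbf A;\widetilde{\boldsymbol\upsilon}_{.j}\big)}{\big(d_r(\mathbf{AA}^*)\big)^2\,\big(d_{r_1}(\mathbf H)\big)^2},\qquad \mathbf H=(\mathbf V^{2k+1})^*\mathbf V^{2k+1},$$ where $\widetilde{\boldsymbol\upsilon}_{.j}$ is the $j$-th column of $\widetilde{\boldsymbol\Upsilon}=\mathbf A^*(\mathbf{AW})^{k+1}\boldsymbol\Upsilon$ and - $\boldsymbol\Upsilon=(\upsilon_{zj})\in\mathbb H^{m\times m}$, $\upsilon_{zj}=R^{r}_{j}(\mathbf{AA}^*;\boldsymbol\psi^{(1)}_{z.})$, with $\boldsymbol\psi^{(1)}_{z.}$ the $z$-th row of $\boldsymbol\Psi^{(1)}=\widehat{\boldsymbol\Psi}\mathbf{WAA}^*$; - $\widehat{\boldsymbol\Psi}=(\widehat\psi_{zs})\in\mathbb H^{m\times n}$, $\widehat\psi_{zs}=C^{r_1}_{z}(\mathbf H;\widetilde{\boldsymbol\psi}_{.s})$, with $\widetilde{\boldsymbol\psi}_{.s}$ the $s$-th column of $\widetilde{\boldsymbol\Psi}=(\mathbf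 V^{2k+1})^*\mathbf V^{2k}\boldsymbol\Psi\mathbf A$; - $\boldsymbol\Psi=(\psi_{lt})\in\mathbb H^{m\times m}$, $\psi_{lt}=C^{r_1}_{l}(\mathbf H;\hat{\mathbf v}_{.t})$, with $\hat{\mathbf v}_{.t}$ the $t$-th column of $\hat{\mathbf V}=(\mathbf V^{2k+1})^*\mathbf V^{k}$. -/

import Mathlib

open scoped Quaternion Matrix

namespace QuatMat

/-! ### Rank and index of quaternion matrices -/

section Rank

/-- The rank of a quaternion matrix: the dimension of its left row space, i.e. of the left
`ℍ`-vector space spanned by its rows. (It equals the dimension of the right column space.) -/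
noncomputable def rk {ι κ : Type*} (A : Matrix ι κ ℍ[ℝ]) : ℕ :=
  Module.finrank ℍ[ℝ] (Submodule.span ℍ[ℝ] (Set.range A.row))

/-- The index of a square quaternion matrix: the smallest positive `k` with
`rk (A ^ (k + 1)) = rk (A ^ k)`. -/
noncomputable def ind {ι : Type*} [Fintype ι] [DecidableEq ι] (A : Matrix ι ι ℍ[ℝ]) : ℕ :=
  sInf {k : ℕ | 0 < k ∧ rk (A ^ (k + 1)) = rk (A ^ k)}

end Rank

/-! ### Auxiliary facts: existence and uniqueness of the generalized inverses -/

section Aux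

theorem exists_pow_eq {B : Type*} [Ring B] [Algebra ℝ B] [FiniteDimensional ℝ B] (h : B) :
    ∃ (k : ℕ) (q : Polynomial ℝ), h ^ k = h ^ (k + 1) * Polynomial.aeval h q := by
  have hint : IsIntegral ℝ h := Algebra.IsIntegral.isIntegral h
  have hp : minpoly ℝ h ≠ 0 := minpoly.ne_zero hint
  obtain ⟨g, hg, hdvd⟩ := Polynomial.exists_eq_pow_rootMultiplicity_mul_and_not_dvd
    (minpoly ℝ h) hp 0
  set k := (minpoly ℝ h).rootMultiplicity 0
  simp only [map_zero, sub_zero] at hg hdvd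
  have hc : g.coeff 0 ≠ 0 := fun h0 => hdvd (Polynomial.X_dvd_iff.mpr h0)
  have h0 : h ^ k * Polynomial.aeval h g = 0 := by
    have := minpoly.aeval ℝ h
    rw [hg] at this
    simpa using this
  refine ⟨k, -(Polynomial.C (g.coeff 0)⁻¹ * g.divX), ?_⟩
  have hsplit := Polynomial.X_mul_divX_add g
  have h1 : Polynomial.aeval h g = h * Polynomial.aeval h g.divX
      + algebraMap ℝ B (g.coeff 0) := by
    conv_lhs => rw [← hsplit, map_add, map_mul, Polynomial.aeval_X, Polynomial.aeval_C]
  rw [h1, mul_add, add_eq_zero_iff_neg_eq] at h0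
  have h2 : h ^ k = (g.coeff 0)⁻¹ • (h ^ k * algebraMap ℝ B (g.coeff 0)) := by
    rw [← Algebra.commutes, ← Algebra.smul_def, smul_smul, inv_mul_cancel₀ hc, one_smul]
  rw [h2, ← h0, map_neg, map_mul, Polynomial.aeval_C, ← Algebra.smul_def, mul_neg,
    mul_smul_comm, smul_neg, pow_succ, mul_assoc]

theorem commute_aeval {B : Type*} [Ring B] [Algebra ℝ B] (h : B) (q : Polynomial ℝ) :
    Commute h (Polynomial.aeval h q) := by
  have := congrArg (Polynomial.aeval h) (mul_comm Polynomial.X q)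
  rwa [map_mul, map_mul, Polynomial.aeval_X] at this

theorem eq_zero_of_conjTranspose_mul_self {ι κ : Type*} [Fintype ι]
    (B : Matrix ι κ ℍ[ℝ]) (h : Bᴴ * B = 0) : B = 0 := by
  ext1 i j
  have hj : (Bᴴ * B) j j = 0 := by rw [h]; rfl
  rw [Matrix.mul_apply] at hj
  have hj' : algebraMap ℝ ℍ[ℝ] (∑ i, Quaternion.normSq (B i j)) = 0 := by
    rw [← hj, map_sum]
    refine Finset.sum_congr rfl fun i _ => ?_
    rw [Matrix.conjTranspose_apply, Quaternion.star_mul_self]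
    rfl
  have hj'' : ∑ i, Quaternion.normSq (B i j) = 0 :=
    (algebraMap ℝ ℍ[ℝ]).injective (hj'.trans (map_zero _).symm)
  rw [Finset.sum_eq_zero_iff_of_nonneg (fun _ _ => Quaternion.normSq_nonneg)] at hj''
  exact Quaternion.normSq_eq_zero.mp (hj'' i (Finset.mem_univ i))

theorem mul_eq_zero_of_conjTranspose_mul {ι κ μ : Type*} [Fintype ι] [Fintype κ]
    (A : Matrix ι κ ℍ[ℝ]) (Z : Matrix κ μ ℍ[ℝ]) (h : Aᴴ * A * Z = 0) : A * Z = 0 := by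
  apply eq_zero_of_conjTranspose_mul_self
  rw [Matrix.conjTranspose_mul, Matrix.mul_assoc, ← Matrix.mul_assoc Aᴴ, h, Matrix.mul_zero]

theorem conjTranspose_aeval {κ : Type*} [Fintype κ] [DecidableEq κ]
    (H : Matrix κ κ ℍ[ℝ]) (hH : Hᴴ = H) (q : Polynomial ℝ) :
    (Polynomial.aeval H q)ᴴ = Polynomial.aeval H q := by
  induction q using Polynomial.induction_on' with
  | add p q hp hq => rw [map_add, Matrix.conjTranspose_add, hp, hq]
  | monomial n a =>
    rw [Polynomial.aeval_monomial, ← Algebra.smul_def]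
    ext1 i j
    rw [Matrix.conjTranspose_apply, Matrix.smul_apply, Matrix.smul_apply, Quaternion.star_smul,
      ← Matrix.conjTranspose_apply, Matrix.conjTranspose_pow, hH]

theorem mem_rowSpace_iff {ι κ : Type*} [Fintype ι] (A : Matrix ι κ ℍ[ℝ]) (v : κ → ℍ[ℝ]) :
    v ∈ Submodule.span ℍ[ℝ] (Set.range A.row) ↔ ∃ c : ι → ℍ[ℝ], Matrix.vecMul c A = v := by
  rw [Submodule.mem_span_range_iff_exists_fun]
  refine exists_congr fun c => ?_
  have : ∑ i, c i • A.row i = Matrix.vecMul c A := by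
    ext1 j
    simp [Matrix.vecMul, dotProduct, Finset.sum_apply]
  rw [this]

theorem rowSpace_mul_le {ι κ μ : Type*} [Fintype ι] [Fintype κ]
    (Y : Matrix ι κ ℍ[ℝ]) (C : Matrix κ μ ℍ[ℝ]) :
    Submodule.span ℍ[ℝ] (Set.range (Y * C).row) ≤ Submodule.span ℍ[ℝ] (Set.range C.row) := by
  rw [Submodule.span_le]
  rintro _ ⟨i, rfl⟩
  exact (mem_rowSpace_iff C _).mpr ⟨Y i, by ext1 j; simp [Matrix.vecMul, Matrix.mul_apply, dotProduct]⟩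

theorem exists_mul_of_rk_eq {ι κ μ : Type*} [Fintype ι] [Fintype κ] [Fintype μ]
    (Y : Matrix ι κ ℍ[ℝ]) (C : Matrix κ μ ℍ[ℝ]) (h : rk (Y * C) = rk C) :
    ∃ T : Matrix κ ι ℍ[ℝ], C = T * (Y * C) := by
  have heq := Submodule.eq_of_le_of_finrank_eq (rowSpace_mul_le Y C) h
  have : ∀ i : κ, ∃ c : ι → ℍ[ℝ], Matrix.vecMul c (Y * C) = C i := fun i => by
    rw [← mem_rowSpace_iff, heq]
    exact Submodule.subset_span ⟨i, rfl⟩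
  choose T hT using this
  refine ⟨Matrix.of T, ?_⟩
  ext1 i j
  rw [← hT i]
  rfl

theorem pow_eq_pow_add {B : Type*} [Monoid B] {v q : B} {k : ℕ}
    (h : v ^ k = v ^ (k + 1) * q) (i : ℕ) : v ^ k = v ^ (k + i) * q ^ i := by
  induction i with
  | zero => simp
  | succ i ih =>
    calc v ^ k = v ^ i * v ^ k * q ^ i := by rw [← pow_add, add_comm i k]; exact ih
      _ = v ^ i * (v ^ (k + 1) * q) * q ^ i := by rw [← h]
      _ = v ^ (k + (i + 1)) * q ^ (i + 1) := by
        rw [pow_succ' q, ← mul_assoc, ← mul_assoc, ← pow_add]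
        congr 3
        omega

variable {κ : Type*} [Fintype κ] [DecidableEq κ]

theorem ind_spec (V : Matrix κ κ ℍ[ℝ]) : rk (V ^ (ind V + 1)) = rk (V ^ ind V) := by
  have hne : {k : ℕ | 0 < k ∧ rk (V ^ (k + 1)) = rk (V ^ k)}.Nonempty := by
    obtain ⟨k, q, hq⟩ := exists_pow_eq V
    refine ⟨k + 1, Nat.succ_pos _, ?_⟩
    have hc : Commute (Polynomial.aeval V q) V := (commute_aeval V q).symm
    unfold rk
    apply congrArg (fun S : Submodule ℍ[ℝ] (κ → ℍ[ℝ]) => Module.finrank ℍ[ℝ] S)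
    apply le_antisymm
    · rw [pow_succ' V (k + 1)]
      exact rowSpace_mul_le _ _
    · have : V ^ (k + 1) = Polynomial.aeval V q * V ^ (k + 1 + 1) := by
        rw [(hc.pow_right _).eq, pow_succ' V (k + 1), mul_assoc, ← hq, ← pow_succ']
      conv_lhs => rw [this]
      exact rowSpace_mul_le _ _
  exact (Nat.sInf_mem hne).2

theorem exists_drazin (V : Matrix κ κ ℍ[ℝ]) :
    ∃ D : Matrix κ κ ℍ[ℝ], V ^ (ind V + 1) * D = V ^ ind V ∧ D * V * D = D ∧ V * D = D * V := by
  set k := ind V with hk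
  obtain ⟨T, hT⟩ := exists_mul_of_rk_eq V (V ^ k) (by rw [← pow_succ']; exact ind_spec V)
  rw [← pow_succ'] at hT
  obtain ⟨j, p, hp⟩ := exists_pow_eq V
  set q := Polynomial.aeval V p
  have hc : Commute V q := commute_aeval V p
  have hT' : ∀ i, V ^ k = T ^ i * V ^ (k + i) := by
    intro i
    induction i with
    | zero => simp
    | succ i ih =>
      calc V ^ k = T ^ i * V ^ (k + i) := ih
        _ = T ^ i * (V ^ k * V ^ i) := by rw [pow_add]
        _ = T ^ i * (T * V ^ (k + 1) * V ^ i) := by rw [← hT]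
        _ = T ^ (i + 1) * V ^ (k + (i + 1)) := by
          rw [mul_assoc T, ← pow_add, pow_succ T, mul_assoc, add_right_comm, add_assoc]
  have hq : V ^ k = V ^ (k + 1) * q := by
    have h1 : V ^ (k + j) = V ^ (k + j) * V * q := by
      rw [← pow_succ, pow_add V k j, hp, ← mul_assoc, ← pow_add]
      rfl
    calc V ^ k = T ^ j * (V ^ (k + j) * V * q) := by rw [← h1]; exact hT' j
      _ = V ^ (k + 1) * q := by rw [← mul_assoc, ← mul_assoc, ← hT' j, ← pow_succ]
  have hpow := pow_eq_pow_add hq (k + 1)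
  refine ⟨V ^ k * q ^ (k + 1), ?_, ?_, ?_⟩
  · rw [← mul_assoc, ← pow_add, hpow]
    congr 2
    omega
  · have hcq : Commute (q ^ (k + 1)) (V * V ^ k) :=
      ((hc.pow_right (k + 1)).symm).mul_right ((hc.pow_pow k (k + 1)).symm)
    calc V ^ k * q ^ (k + 1) * V * (V ^ k * q ^ (k + 1))
        = V ^ k * (q ^ (k + 1) * (V * V ^ k)) * q ^ (k + 1) := by simp only [mul_assoc]
      _ = V ^ (k + (k + 1)) * q ^ (k + 1) * q ^ (k + 1) := by
        rw [hcq.eq, ← pow_succ', ← mul_assoc, ← pow_add]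
      _ = V ^ k * q ^ (k + 1) := by rw [← hpow]
  · exact ((Commute.refl V).pow_right k).mul_right (hc.pow_right (k + 1))

end Aux

/-! ### Moore–Penrose, weighted Drazin and weighted CMP inverses -/

section GenInverses

/-- `X` satisfies the four Penrose equations for `A`. -/
def IsMoorePenrose {ι κ : Type*} [Fintype ι] [Fintype κ]
    (A : Matrix ι κ ℍ[ℝ]) (X : Matrix κ ι ℍ[ℝ]) : Prop :=
  A * X * A = A ∧ X * A * X = X ∧ (A * X)ᴴ = A * X ∧ (X * A)ᴴ = X * A

theorem existsUnique_moorePenrose {ι κ : Type*} [Fintype ι] [Fintype κ] [DecidableEq κ]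
    (A : Matrix ι κ ℍ[ℝ]) : ∃! X : Matrix κ ι ℍ[ℝ], IsMoorePenrose A X := by
  obtain ⟨k, q, hq⟩ := exists_pow_eq (Aᴴ * A)
  set H := Aᴴ * A with hHdef
  have hH : Hᴴ = H := by simp [hHdef, Matrix.conjTranspose_mul]
  set s := Polynomial.aeval H q
  have hs : sᴴ = s := conjTranspose_aeval H hH q
  have hc : Commute H s := commute_aeval H q
  have hcancel : ∀ (i : ℕ) (Y : Matrix κ κ ℍ[ℝ]), H ^ i * Y = 0 → H * Y = 0 := by
    intro i
    induction i with
    | zero => intro Y h; rw [pow_zero, one_mul] at h; rw [h, mul_zero]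
    | succ i ih =>
      intro Y h
      rw [pow_succ, mul_assoc] at h
      have h2 := ih _ h
      apply mul_eq_zero_of_conjTranspose_mul
      rw [hH, mul_assoc]
      exact h2
  have h1 : H * (1 - H * s) = 0 := by
    apply hcancel k
    rw [mul_sub, mul_one, ← mul_assoc, ← pow_succ, ← hq, sub_self]
  have h2 : A * (1 - H * s) = 0 := mul_eq_zero_of_conjTranspose_mul _ _ h1
  have h3 : A * (H * s) = A := by
    rw [Matrix.mul_sub, Matrix.mul_one, sub_eq_zero] at h2
    exact h2.symm
  have h4 : s * H * Aᴴ = Aᴴ := by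
    have := congrArg Matrix.conjTranspose h3
    rwa [Matrix.conjTranspose_mul, Matrix.conjTranspose_mul, hs, hH] at this
  have hsA : s * Aᴴ * A = H * s := by rw [Matrix.mul_assoc, ← hHdef, hc.eq]
  have hmp : IsMoorePenrose A (s * Aᴴ) := by
    refine ⟨?_, ?_, ?_, ?_⟩
    · rw [Matrix.mul_assoc, hsA, h3]
    · rw [hsA, ← Matrix.mul_assoc, hc.eq, mul_assoc, hc.eq, Matrix.mul_assoc, h4]
    · rw [Matrix.conjTranspose_mul, Matrix.conjTranspose_mul, hs,
        Matrix.conjTranspose_conjTranspose, Matrix.mul_assoc]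
    · rw [hsA, Matrix.conjTranspose_mul, hs, hH, hc.eq]
  refine ⟨s * Aᴴ, hmp, fun Y hY => ?_⟩
  have huniq : ∀ X Y : Matrix κ ι ℍ[ℝ], IsMoorePenrose A X → IsMoorePenrose A Y → X = Y := by
    rintro X Y ⟨x1, x2, x3, x4⟩ ⟨y1, y2, y3, y4⟩
    have e1 : A * X = A * Y := by
      calc A * X = (A * X)ᴴ := x3.symm
        _ = (A * Y * (A * X))ᴴ := by rw [← Matrix.mul_assoc, y1]
        _ = A * X * (A * Y) := by rw [Matrix.conjTranspose_mul, x3, y3]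
        _ = A * Y := by rw [← Matrix.mul_assoc, x1]
    have e2 : X * A = Y * A := by
      calc X * A = (X * A)ᴴ := x4.symm
        _ = (X * A * (Y * A))ᴴ := by
          rw [Matrix.mul_assoc X A, ← Matrix.mul_assoc A, y1]
        _ = Y * A * (X * A) := by rw [Matrix.conjTranspose_mul, x4, y4]
        _ = Y * A := by rw [Matrix.mul_assoc, ← Matrix.mul_assoc A, x1]
    calc X = X * A * X := x2.symm
      _ = Y * A * X := by rw [e2]
      _ = Y * A * Y := by rw [Matrix.mul_assoc, e1, ← Matrix.mul_assoc]
      _ = Y := y2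
  exact huniq Y _ hY hmp

/-- The Moore–Penrose inverse `A†`: the unique solution of the Penrose equations. -/
noncomputable def mpInv {ι κ : Type*} [Fintype ι] [Fintype κ] [DecidableEq κ]
    (A : Matrix ι κ ℍ[ℝ]) : Matrix κ ι ℍ[ℝ] :=
  (existsUnique_moorePenrose A).choose

/-- `X` satisfies the defining equations of the `W`-weighted Drazin inverse of `A`,
where `k = Ind (A W)`. -/
def IsWDrazin {ι κ : Type*} [Fintype ι] [Fintype κ] [DecidableEq ι]
    (A : Matrix ι κ ℍ[ℝ]) (W : Matrix κ ι ℍ[ℝ]) (X : Matrix ι κ ℍ[ℝ]) : Prop :=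
  (A * W) ^ (ind (A * W) + 1) * X * W = (A * W) ^ ind (A * W) ∧
    X * W * A * W * X = X ∧ A * W * X = X * W * A

theorem existsUnique_wDrazin {ι κ : Type*} [Fintype ι] [Fintype κ] [DecidableEq ι]
    (A : Matrix ι κ ℍ[ℝ]) (W : Matrix κ ι ℍ[ℝ]) :
    ∃! X : Matrix ι κ ℍ[ℝ], IsWDrazin A W X := by
  obtain ⟨D, d1, d2, d3⟩ := exists_drazin (A * W)
  set V := A * W with hV
  set k := ind V
  have hW : D * D * A * W = D := by
    rw [Matrix.mul_assoc, ← hV, mul_assoc, ← d3, ← mul_assoc, d2]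
  have hL : V * (D * D * A) = D * A := by
    rw [← Matrix.mul_assoc, ← mul_assoc, d3, d2]
  refine ⟨D * D * A, ⟨?_, ?_, ?_⟩, ?_⟩
  · rw [← hV, Matrix.mul_assoc, hW, d1]
  · rw [hW, Matrix.mul_assoc D A W, ← hV, Matrix.mul_assoc, hL, ← Matrix.mul_assoc]
  · rw [← hV, hL, hW]
  · rintro X ⟨x1, x2, x3⟩
    rw [← hV] at x1 x3
    have z1 : V ^ (k + 1) * (X * W) = V ^ k := by rw [← Matrix.mul_assoc]; exact x1
    have z3 : V * (X * W) = X * W * V := by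
      rw [← Matrix.mul_assoc, x3, Matrix.mul_assoc (X * W) A W]
    have z2 : X * W * V * (X * W) = X * W := by
      rw [hV, ← Matrix.mul_assoc, ← Matrix.mul_assoc, x2]
    set Z := X * W with hZ
    have key : ∀ P Q : Matrix ι ι ℍ[ℝ], V ^ (k + 1) * P = V ^ k → P * V * P = P → V * P = P * V →
        V ^ (k + 1) * Q = V ^ k → Q * V * Q = Q → V * Q = Q * V → P = P * V * Q := by
      intro P Q p1 p2 p3 q1 q2 q3
      have hp : ∀ i, P = P ^ (i + 1) * V ^ i := by
        intro i
        induction i with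
        | zero => simp
        | succ i ih =>
          have hc : Commute V P := p3
          calc P = P * V * P := p2.symm
            _ = P * V * (P ^ (i + 1) * V ^ i) := by rw [← ih]
            _ = P * (V * P ^ (i + 1)) * V ^ i := by simp only [mul_assoc]
            _ = P * (P ^ (i + 1) * V) * V ^ i := by rw [(hc.pow_right (i + 1)).eq]
            _ = P ^ (i + 1 + 1) * V ^ (i + 1) := by
              rw [pow_succ' P (i + 1), pow_succ' V i]
              simp only [mul_assoc]
      calc P = P ^ (k + 1) * V ^ k := hp k
        _ = P ^ (k + 1) * (V ^ (k + 1) * Q) := by rw [q1]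
        _ = P ^ (k + 1) * V ^ k * V * Q := by rw [pow_succ V]; simp only [mul_assoc]
        _ = P * V * Q := by rw [← hp k]
    have a1 := key Z D z1 z2 z3 d1 d2 d3
    have a2 := key D Z d1 d2 d3 z1 z2 z3
    have hc1 : Commute V Z := z3
    have hc2 : Commute V D := d3
    have hZD : Z = D := by
      have kw : ∀ P Q : Matrix ι ι ℍ[ℝ], V ^ (k + 1) * P = V ^ k → P * V * P = P →
          V * P = P * V → V ^ (k + 1) * Q = V ^ k → Q * V * Q = Q → V * Q = Q * V →
          P = Q * V * P := by
        intro P Q p1 p2 p3 q1 q2 q3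
        have hp : ∀ i, P = V ^ i * P ^ (i + 1) := by
          intro i
          induction i with
          | zero => simp
          | succ i ih =>
            have hc : Commute V P := p3
            calc P = P * V * P := p2.symm
              _ = V * P * P := by rw [p3]
              _ = V * (V ^ i * P ^ (i + 1)) * P := by rw [← ih]
              _ = V ^ (i + 1) * P ^ (i + 1 + 1) := by
                rw [pow_succ' V i, pow_succ P (i + 1)]
                simp only [mul_assoc]
        have hq : Q * V ^ (k + 1) = V ^ k := by
          have hc : Commute V Q := q3
          rw [← (hc.pow_left (k + 1)).eq, q1]
        calc P = V ^ k * P ^ (k + 1) := hp k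
          _ = Q * V ^ (k + 1) * P ^ (k + 1) := by rw [hq]
          _ = Q * V * (V ^ k * P ^ (k + 1)) := by rw [pow_succ' V]; simp only [mul_assoc]
          _ = Q * V * P := by rw [← hp k]
      exact (kw Z D z1 z2 z3 d1 d2 d3).trans a2.symm
    calc X = Z * A * W * X := x2.symm
      _ = Z * (V * X) := by rw [hV]; simp only [Matrix.mul_assoc]
      _ = D * D * A := by rw [x3, hZD]; simp only [Matrix.mul_assoc]

/-- The `W`-weighted Drazin inverse `A^{d,W}`: the unique solution of its defining equations. -/
noncomputable def wDrazin {ι κ : Type*} [Fintype ι] [Fintype κ] [DecidableEq ι]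
    (A : Matrix ι κ ℍ[ℝ]) (W : Matrix κ ι ℍ[ℝ]) : Matrix ι κ ℍ[ℝ] :=
  (existsUnique_wDrazin A W).choose

/-- The weighted CMP inverse `A^{c,†,W} = A† A W A^{d,W} W A A†`. -/
noncomputable def wCMP {ι κ : Type*} [Fintype ι] [Fintype κ] [DecidableEq ι] [DecidableEq κ]
    (A : Matrix ι κ ℍ[ℝ]) (W : Matrix κ ι ℍ[ℝ]) : Matrix κ ι ℍ[ℝ] :=
  mpInv A * A * W * wDrazin A W * W * A * mpInv A

end GenInverses

/-! ### Row and column determinants -/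

section Determinants

variable {ι : Type*} [Fintype ι] [LinearOrder ι]

/-- The product of entries along the cycle of `σ` through `s`, read off starting from `s`:
`a_{s, σ s} a_{σ s, σ² s} ⋯ a_{σˡ s, s}`, where `l + 1` is the length of the cycle. -/
noncomputable def cycleProd (A : Matrix ι ι ℍ[ℝ]) (σ : Equiv.Perm ι) (s : ι) : ℍ[ℝ] :=
  ((List.range (Function.minimalPeriod σ s)).map
    fun t => A ((σ ^ t) s) ((σ ^ (t + 1)) s)).prod

open scoped Classical in
/-- The least elements of the cycles of `σ` (fixed points included) that do not contain `i`,
in increasing order. -/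
noncomputable def leaders (σ : Equiv.Perm ι) (i : ι) : List ι :=
  (Finset.univ.filter fun s => ¬ σ.SameCycle i s ∧ ∀ t, σ.SameCycle s t → s ≤ t).sort (· ≤ ·)

/-- The `i`-th row determinant. Each permutation is written as a product of disjoint cycles: the
first cycle from the left starts with `i`, every other one starts with its least element, and
these least elements increase from left to right. The sign is `(-1) ^ (n - r)`, where `r` is the
number of cycles. -/
noncomputable def rdet (i : ι) (A : Matrix ι ι ℍ[ℝ]) : ℍ[ℝ] :=
  ∑ σ : Equiv.Perm ι, (-1 : ℍ[ℝ]) ^ (Fintype.card ι - ((leaders σ i).length + 1)) *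
    (cycleProd A σ i * ((leaders σ i).map (cycleProd A σ)).prod)

/-- The `j`-th column determinant. Here the cycles are ordered from right to left: the first cycle
from the right is the one of `j`, every other one is closed at its least element, and these least
elements increase from right to left. -/
noncomputable def cdet (j : ι) (A : Matrix ι ι ℍ[ℝ]) : ℍ[ℝ] :=
  ∑ τ : Equiv.Perm ι, (-1 : ℍ[ℝ]) ^ (Fintype.card ι - ((leaders τ j).length + 1)) *
    (((leaders τ j).reverse.map (cycleProd A τ)).prod * cycleProd A τ j)

open scoped Classical in
/-- The determinant of a Hermitian matrix, expanded along its first row (for Hermitian matrices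
all row and column determinants agree). The determinant of the empty matrix is `1`. -/
noncomputable def hdet (A : Matrix ι ι ℍ[ℝ]) : ℍ[ℝ] :=
  if h : (Finset.univ : Finset ι).Nonempty then rdet (Finset.univ.min' h) A else 1

/-- The principal submatrix with rows and columns indexed by `α`. -/
def principal (B : Matrix ι ι ℍ[ℝ]) (α : Finset ι) : Matrix α α ℍ[ℝ] :=
  B.submatrix (fun x => (x : ι)) (fun x => (x : ι))

/-- `∑_{α ∈ I_r{j}} rdet_j ((B_{j.}(b))_α^α)`: the sum over the `r`-element index sets `α`
containing `j`, where the `j`-th row of `B` is replaced with `b`. -/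
noncomputable def rdetSum (r : ℕ) (B : Matrix ι ι ℍ[ℝ]) (j : ι) (b : ι → ℍ[ℝ]) : ℍ[ℝ] :=
  ∑ α : {α : Finset ι // α.card = r ∧ j ∈ α},
    rdet (⟨j, α.2.2⟩ : α.1) (principal (B.updateRow j b) α.1)

/-- `∑_{β ∈ J_r{i}} cdet_i ((B_{.i}(c))_β^β)`: the sum over the `r`-element index sets `β`
containing `i`, where the `i`-th column of `B` is replaced with `c`. -/
noncomputable def cdetSum (r : ℕ) (B : Matrix ι ι ℍ[ℝ]) (i : ι) (c : ι → ℍ[ℝ]) : ℍ[ℝ] :=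
  ∑ β : {β : Finset ι // β.card = r ∧ i ∈ β},
    cdet (⟨i, β.2.2⟩ : β.1) (principal (B.updateCol i c) β.1)

/-- `∑_α |B|_α^α`: the sum of the principal minors of order `r` of a Hermitian matrix `B`. -/
noncomputable def minorSum (r : ℕ) (B : Matrix ι ι ℍ[ℝ]) : ℍ[ℝ] :=
  ∑ α : {α : Finset ι // α.card = r}, hdet (principal B α.1)

end Determinants

end QuatMat

open QuatMat

/-!
For a Hermitian matrix `B` let `C_q` be the sum over all `α` with `q` elements of the cofactor
matrix of `B_α^α`, extended by zero. The Laplace expansion of row determinants gives the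
Faddeev–LeVerrier recursion `C_{q+1} = d_q(B) - B C_q`, and `R^q_j(B; b)` is the `j`-th entry of
`b C_q`. For the largest `s` with `d_s(B) ≠ 0` the powers of `-B` kill `C_{s+1}`, hence so does
`B`, and `d_s(B)⁻¹ B C_s` is the projection onto the range of `B`. Its trace is `s`, so `s` is
the rank of `B`. For `B = A A*` with `r = rk A` this reads `A* C_r = d_r(A A*) A†`, hence the rows
of a matrix of the form `Y A*` have row-determinantal sums `d_r(A A*) Y A†`.

The weighted CMP inverse is expressed through Moore–Penrose inverses alone:
`W A^{d,W}` and `A^{d,W} W` are the Drazin inverses of `U = WA` and `V = AW`, and the Drazin inverse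
of `U` is `U^k (U^{2k+1})† U^k`. Each auxiliary matrix of the theorem therefore multiplies by one
of these Moore–Penrose inverses and by the corresponding `d_r` or `d_{r₁}`.
-/

namespace QuatMat

open Equiv Equiv.Perm Finset

section Cycles

variable {κ : Type*} {σ : Perm κ} {s : κ}

theorem sameCycle_of_pow_apply_eq {t : κ} {n : ℕ} (h : (σ ^ n) s = t) : σ.SameCycle s t :=
  ⟨n, by rwa [zpow_natCast]⟩

theorem sameCycle_iff_exists_nat_pow [Finite κ] {t : κ} :
    σ.SameCycle s t ↔ ∃ n : ℕ, (σ ^ n) s = t :=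
  ⟨fun h => h.exists_nat_pow_eq, fun ⟨_, hn⟩ => sameCycle_of_pow_apply_eq hn⟩

theorem not_sameCycle_of_fixed {t : κ} (ht : σ t = t) (hs : s ≠ t) : ¬ σ.SameCycle s t :=
  fun h => hs (h.eq_of_right ht)

theorem minimalPeriod_congr {μ : Type*} {ρ : Perm μ} {t : μ}
    (h : ∀ n : ℕ, (σ ^ n) s = s ↔ (ρ ^ n) t = t) :
    Function.minimalPeriod σ s = Function.minimalPeriod ρ t :=
  Function.minimalPeriod_eq_minimalPeriod_iff.mpr fun n => by
    simpa only [Function.IsPeriodicPt, Function.IsFixedPt, iterate_eq_pow] using h n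

theorem minimalPeriod_pos [Finite κ] (σ : Perm κ) (s : κ) : 0 < Function.minimalPeriod σ s :=
  Function.minimalPeriod_pos_of_mem_periodicPts (σ.injective.mem_periodicPts s)

theorem pow_minimalPeriod_apply (σ : Perm κ) (s : κ) :
    (σ ^ Function.minimalPeriod σ s) s = s := by
  rw [← iterate_eq_pow]
  exact Function.isPeriodicPt_minimalPeriod σ s

theorem pow_apply_ne_of_lt_minimalPeriod {n : ℕ} (h0 : n ≠ 0)
    (h : n < Function.minimalPeriod σ s) : (σ ^ n) s ≠ s := by
  rw [← iterate_eq_pow]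
  exact Function.not_isPeriodicPt_of_pos_of_lt_minimalPeriod h0 h

end Cycles

section Splice

variable {κ : Type*} [DecidableEq κ] {τ : Perm κ} {i j s : κ}

theorem mul_swap_pow_apply (hj : ¬ τ.SameCycle s j) (hi : ¬ τ.SameCycle s i) (n : ℕ) :
    ((τ * swap j i) ^ n) s = (τ ^ n) s := by
  induction n with
  | zero => rfl
  | succ n ih =>
    rw [pow_succ', Perm.mul_apply, ih, Perm.mul_apply, swap_apply_of_ne_of_ne, pow_succ',
      Perm.mul_apply]
    · exact fun h => hj (sameCycle_of_pow_apply_eq h)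
    · exact fun h => hi (sameCycle_of_pow_apply_eq h)

theorem sameCycle_mul_swap_iff_of_not_sameCycle [Finite κ] {t : κ} (hj : ¬ τ.SameCycle s j)
    (hi : ¬ τ.SameCycle s i) : (τ * swap j i).SameCycle s t ↔ τ.SameCycle s t := by
  simp only [sameCycle_iff_exists_nat_pow, mul_swap_pow_apply hj hi]

theorem sameCycle_mul_swap_iff [Finite κ] (hi : τ i = i) :
    (τ * swap j i).SameCycle j s ↔ s = i ∨ τ.SameCycle j s := by
  have hji : (τ * swap j i).SameCycle j i := ⟨1, by simp [hi]⟩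
  refine ⟨fun h => ?_, ?_⟩
  · by_contra! hs
    have hsj : ¬ τ.SameCycle s j := fun h => hs.2 h.symm
    have hsi : ¬ τ.SameCycle s i := not_sameCycle_of_fixed hi hs.1
    exact hsj ((sameCycle_mul_swap_iff_of_not_sameCycle hsj hsi).mp h.symm)
  · rintro (rfl | h)
    · exact hji
    · by_contra hs
      have hsj : ¬ (τ * swap j i).SameCycle s j := fun h' => hs h'.symm
      have hsi : ¬ (τ * swap j i).SameCycle s i := fun h' => hs (hji.trans h'.symm)
      refine hsj ((sameCycle_mul_swap_iff_of_not_sameCycle hsj hsi).mp ?_)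
      rw [mul_assoc, swap_mul_self, mul_one]
      exact h.symm

theorem mul_swap_pow_succ_apply (hij : i ≠ j) (hi : τ i = i) {n : ℕ} (h0 : n ≠ 0)
    (hn : n ≤ Function.minimalPeriod τ j) : ((τ * swap j i) ^ (n + 1)) j = (τ ^ n) j := by
  induction n with
  | zero => exact absurd rfl h0
  | succ n ih =>
    rcases eq_or_ne n 0 with rfl | h0
    · simp [pow_two, hi]
    · have hnj : (τ ^ n) j ≠ j := pow_apply_ne_of_lt_minimalPeriod h0 hn
      have hni : (τ ^ n) j ≠ i := fun h =>
        not_sameCycle_of_fixed hi hij.symm (sameCycle_of_pow_apply_eq h)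
      rw [pow_succ', Perm.mul_apply, ih h0 (Nat.le_of_succ_le hn), Perm.mul_apply,
        swap_apply_of_ne_of_ne hnj hni, pow_succ' τ, Perm.mul_apply]

theorem minimalPeriod_mul_swap [Finite κ] (hij : i ≠ j) (hi : τ i = i) :
    Function.minimalPeriod (τ * swap j i) j = Function.minimalPeriod τ j + 1 := by
  have hpow := pow_minimalPeriod_apply (τ * swap j i) j
  refine le_antisymm (Function.IsPeriodicPt.minimalPeriod_le (Nat.succ_pos _) ?_) ?_
  · change (τ * swap j i)^[_] j = j
    rw [iterate_eq_pow, mul_swap_pow_succ_apply hij hi (minimalPeriod_pos τ j).ne' le_rfl,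
      pow_minimalPeriod_apply]
  · obtain ⟨q, hq⟩ := Nat.exists_eq_succ_of_ne_zero (minimalPeriod_pos (τ * swap j i) j).ne'
    rw [hq] at hpow ⊢
    by_contra! hlt
    rcases eq_or_ne q 0 with rfl | h0
    · exact hij (by simpa [hi] using hpow)
    · rw [mul_swap_pow_succ_apply hij hi h0 (by omega)] at hpow
      exact pow_apply_ne_of_lt_minimalPeriod h0 (by omega) hpow

end Splice

section CycleProd

variable {ι : Type*} {σ τ : Perm ι} {i j s : ι}

theorem cycleProd_congr {M M' : Matrix ι ι ℍ[ℝ]} (hpow : ∀ n : ℕ, (σ ^ n) s = (τ ^ n) s)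
    (hM : ∀ t, τ.SameCycle s t → M t = M' t) : cycleProd M σ s = cycleProd M' τ s := by
  have hp : Function.minimalPeriod σ s = Function.minimalPeriod τ s :=
    minimalPeriod_congr fun n => by rw [hpow n]
  rw [cycleProd, cycleProd, hp]
  congr 1
  refine List.map_congr_left fun n _ => ?_
  rw [hpow, hpow, hM _ (sameCycle_of_pow_apply_eq rfl)]

theorem cycleProd_updateRow_of_not_sameCycle [DecidableEq ι] {M : Matrix ι ι ℍ[ℝ]} {b : ι → ℍ[ℝ]}
    (hj : ¬ σ.SameCycle j s) : cycleProd (M.updateRow j b) σ s = cycleProd M σ s :=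
  cycleProd_congr (fun _ => rfl) fun _ ht =>
    Matrix.updateRow_ne fun h => hj (SameCycle.symm (h ▸ ht))

theorem cycleProd_of_fixed {M : Matrix ι ι ℍ[ℝ]} (h : σ s = s) : cycleProd M σ s = M s s := by
  have hp : Function.minimalPeriod σ s = 1 := Function.minimalPeriod_eq_one_iff_isFixedPt.mpr h
  simp [cycleProd, hp, List.range_succ, h]

theorem cycleProd_mul_swap [Finite ι] [DecidableEq ι] (hij : i ≠ j) (hi : τ i = i)
    (M : Matrix ι ι ℍ[ℝ]) (b : ι → ℍ[ℝ]) :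
    cycleProd (M.updateRow j b) (τ * swap j i) j = b i * cycleProd (M.updateRow j (M i)) τ j := by
  rw [cycleProd, minimalPeriod_mul_swap hij hi, List.range_succ_eq_map, List.map_cons,
    List.prod_cons, List.map_map]
  congr 1
  · simp [hi]
  · rw [cycleProd]
    congr 1
    refine List.map_congr_left fun n hn => ?_
    rw [List.mem_range] at hn
    simp only [Function.comp_apply, Nat.succ_eq_add_one]
    rw [mul_swap_pow_succ_apply hij hi n.succ_ne_zero hn]
    rcases eq_or_ne n 0 with rfl | h0
    · simp [hi, hij]
    · have hne : (τ ^ n) j ≠ j := pow_apply_ne_of_lt_minimalPeriod h0 hn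
      rw [mul_swap_pow_succ_apply hij hi h0 hn.le, Matrix.updateRow_ne hne, Matrix.updateRow_ne hne]

end CycleProd

section SupportedPerms

variable {ι : Type*} [DecidableEq ι] {α : Finset ι} {σ : Perm ι} {i j s t : ι}

theorem apply_eq_of_mem_permsOfFinset (hσ : σ ∈ permsOfFinset α) (hs : s ∉ α) : σ s = s := by
  by_contra h
  exact hs (mem_perms_of_finset_iff.mp hσ h)

theorem mem_of_sameCycle (hσ : σ ∈ permsOfFinset α) (hst : σ.SameCycle s t) (hs : s ∈ α) :
    t ∈ α := by
  by_contra ht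
  exact ht (hst.eq_of_right (apply_eq_of_mem_permsOfFinset hσ ht) ▸ hs)

theorem mem_permsOfFinset_erase :
    σ ∈ permsOfFinset (α.erase j) ↔ σ ∈ permsOfFinset α ∧ σ j = j := by
  simp only [mem_perms_of_finset_iff, mem_erase]
  exact ⟨fun h => ⟨fun hs => (h hs).2, by_contra fun hj => (h hj).1 rfl⟩,
    fun h _ hs => ⟨fun hsj => hs (hsj ▸ h.2), h.1 hs⟩⟩

theorem mul_swap_mem_permsOfFinset (hσ : σ ∈ permsOfFinset α) (hi : i ∈ α) (hj : j ∈ α) :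
    σ * swap j i ∈ permsOfFinset α := by
  refine mem_perms_of_finset_iff.mpr fun {s} hs => by_contra fun hsα => hs ?_
  rw [Perm.mul_apply, swap_apply_of_ne_of_ne (ne_of_mem_of_not_mem hj hsα).symm
    (ne_of_mem_of_not_mem hi hsα).symm, apply_eq_of_mem_permsOfFinset hσ hsα]

theorem sum_permsOfFinset_eq_sum_mul_swap {N : Type*} [AddCommMonoid N] (hj : j ∈ α)
    (f : Perm ι → N) : ∑ σ ∈ permsOfFinset α, f σ =
      ∑ i ∈ α, ∑ τ ∈ permsOfFinset (α.erase i), f (τ * swap j i) := by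
  have hmaps : ∀ σ ∈ permsOfFinset α, σ j ∈ α := fun σ hσ =>
    mem_of_sameCycle hσ ⟨1, by simp⟩ hj
  rw [← sum_fiberwise_of_maps_to hmaps]
  refine sum_congr rfl fun i hi => ?_
  refine sum_bij' (fun σ _ => σ * swap j i) (fun τ _ => τ * swap j i) ?_ ?_ ?_ ?_ ?_
  · intro σ hσ
    obtain ⟨hσ, hσj⟩ := mem_filter.mp hσ
    exact mem_permsOfFinset_erase.mpr ⟨mul_swap_mem_permsOfFinset hσ hi hj, by simp [hσj]⟩
  · intro τ hτ
    obtain ⟨hτ, hτi⟩ := mem_permsOfFinset_erase.mp hτ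
    exact mem_filter.mpr ⟨mul_swap_mem_permsOfFinset hτ hi hj, by simp [hτi]⟩
  all_goals simp [mul_assoc]

theorem sum_perm_ofSubtype {N : Type*} [AddCommMonoid N] (f : Perm ι → N) :
    ∑ σ : Perm α, f (ofSubtype σ) = ∑ σ ∈ permsOfFinset α, f σ := by
  have hmem : ∀ σ : Perm ι, σ ∈ permsOfFinset α ↔ ∀ s, s ∉ α → σ s = s := fun σ =>
    ⟨fun hσ _ => apply_eq_of_mem_permsOfFinset hσ, fun h =>
      mem_perms_of_finset_iff.mpr fun {s} hs => by_contra fun hsα => hs (h s hsα)⟩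
  classical
  have : Fintype {σ : Perm ι // ∀ s, s ∉ α → σ s = s} := Fintype.ofEquiv _
    (Perm.subtypeEquivSubtypePerm (· ∈ α))
  rw [sum_subtype _ hmem]
  exact Fintype.sum_equiv (Perm.subtypeEquivSubtypePerm (· ∈ α)) _ _ fun _ => rfl

end SupportedPerms

section PermDeterminants

variable {ι : Type*} [LinearOrder ι] {α : Finset ι} {σ τ : Perm ι} {i j s : ι}

open scoped Classical in
/-- The least elements of the cycles of `σ` on `α`, for a permutation `σ` that is the identity
outside `α`. -/
noncomputable def cycleMins (α : Finset ι) (σ : Perm ι) : Finset ι :=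
  α.filter fun s => ∀ t, σ.SameCycle s t → s ≤ t

open scoped Classical in
/-- The least elements of the cycles of `σ` on `α` other than the cycle of `j`. -/
noncomputable def cycleMinsAvoiding (α : Finset ι) (σ : Perm ι) (j : ι) : Finset ι :=
  (cycleMins α σ).filter fun s => ¬ σ.SameCycle j s

/-- The product of the cycles of `σ` through the elements of `S`, in increasing order of those
elements. -/
noncomputable def orderedCycleProd (M : Matrix ι ι ℍ[ℝ]) (σ : Perm ι) (S : Finset ι) : ℍ[ℝ] :=
  ((S.sort (· ≤ ·)).map (cycleProd M σ)).prod

/-- The summand of `σ` in the `j`-th row determinant of the principal submatrix on `α`. -/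
noncomputable def rdetTerm (α : Finset ι) (j : ι) (M : Matrix ι ι ℍ[ℝ]) (σ : Perm ι) : ℍ[ℝ] :=
  (-1 : ℍ[ℝ]) ^ (α.card - ((cycleMinsAvoiding α σ j).card + 1)) *
    (cycleProd M σ j * orderedCycleProd M σ (cycleMinsAvoiding α σ j))

/-- The `j`-th row determinant of the principal submatrix on `α`, written with permutations of the
ambient index type so that different `α` can be compared; meaningful for `j ∈ α`. -/
noncomputable def rdetOn (α : Finset ι) (j : ι) (M : Matrix ι ι ℍ[ℝ]) : ℍ[ℝ] :=
  ∑ σ ∈ permsOfFinset α, rdetTerm α j M σ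

/-- The summand of `σ` in `minorOn`. -/
noncomputable def minorTerm (α : Finset ι) (M : Matrix ι ι ℍ[ℝ]) (σ : Perm ι) : ℍ[ℝ] :=
  (-1 : ℍ[ℝ]) ^ (α.card - (cycleMins α σ).card) * orderedCycleProd M σ (cycleMins α σ)

/-- The principal minor on `α`, every cycle starting with its least element; this is the row
determinant along the row of the least element of `α`. -/
noncomputable def minorOn (α : Finset ι) (M : Matrix ι ι ℍ[ℝ]) : ℍ[ℝ] :=
  ∑ σ ∈ permsOfFinset α, minorTerm α M σ

theorem orderedCycleProd_congr {M M' : Matrix ι ι ℍ[ℝ]} {S : Finset ι}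
    (h : ∀ s ∈ S, cycleProd M σ s = cycleProd M' τ s) :
    orderedCycleProd M σ S = orderedCycleProd M' τ S := by
  rw [orderedCycleProd, List.map_congr_left fun s hs => h s ((mem_sort _).mp hs), orderedCycleProd]

theorem mem_cycleMins : s ∈ cycleMins α σ ↔ s ∈ α ∧ ∀ t, σ.SameCycle s t → s ≤ t := by
  simp [cycleMins]

theorem mem_cycleMinsAvoiding :
    s ∈ cycleMinsAvoiding α σ j ↔ s ∈ cycleMins α σ ∧ ¬ σ.SameCycle j s := by
  simp [cycleMinsAvoiding]

theorem mem_of_mem_cycleMinsAvoiding (h : s ∈ cycleMinsAvoiding α σ j) : s ∈ α :=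
  (mem_cycleMins.mp (mem_cycleMinsAvoiding.mp h).1).1

theorem not_sameCycle_of_mem_cycleMinsAvoiding (h : s ∈ cycleMinsAvoiding α σ j) :
    ¬ σ.SameCycle j s :=
  (mem_cycleMinsAvoiding.mp h).2

theorem cycleMinsAvoiding_of_fixed (hj : σ j = j) :
    cycleMinsAvoiding α σ j = cycleMins (α.erase j) σ := by
  have hiff : ∀ s, ¬ σ.SameCycle j s ↔ s ≠ j := fun s =>
    ⟨fun h hs => h (hs ▸ SameCycle.refl σ s), fun h hs => h (hs.eq_of_left hj).symm⟩
  ext s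
  simp only [mem_cycleMinsAvoiding, mem_cycleMins, mem_erase, hiff]
  tauto

theorem cycleMinsAvoiding_mul_swap [Finite ι] (hi : τ i = i) :
    cycleMinsAvoiding α (τ * swap j i) j = cycleMinsAvoiding (α.erase i) τ j := by
  have hiff : ∀ s, s ≠ i → ¬ τ.SameCycle j s → ∀ t,
      (τ * swap j i).SameCycle s t ↔ τ.SameCycle s t := fun s hs hjs t =>
    sameCycle_mul_swap_iff_of_not_sameCycle (fun h => hjs h.symm) (not_sameCycle_of_fixed hi hs)
  ext s
  simp only [mem_cycleMinsAvoiding, mem_cycleMins, mem_erase, sameCycle_mul_swap_iff hi, not_or]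
  constructor
  · rintro ⟨⟨hs, hmin⟩, hsi, hjs⟩
    exact ⟨⟨⟨hsi, hs⟩, fun t ht => hmin t ((hiff s hsi hjs t).mpr ht)⟩, hjs⟩
  · rintro ⟨⟨⟨hsi, hs⟩, hmin⟩, hjs⟩
    exact ⟨⟨hs, fun t ht => hmin t ((hiff s hsi hjs t).mp ht)⟩, hsi, hjs⟩

theorem card_cycleMinsAvoiding_lt (hj : j ∈ α) : (cycleMinsAvoiding α σ j).card < α.card := by
  refine card_lt_card ((ssubset_iff_of_subset fun s => mem_of_mem_cycleMinsAvoiding).mpr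
    ⟨j, hj, fun h => ?_⟩)
  exact not_sameCycle_of_mem_cycleMinsAvoiding h (SameCycle.refl σ j)

theorem rdetTerm_updateRow_of_fixed (hj : j ∈ α) (hσ : σ j = j) (M : Matrix ι ι ℍ[ℝ])
    (b : ι → ℍ[ℝ]) : rdetTerm α j (M.updateRow j b) σ = b j * minorTerm (α.erase j) M σ := by
  have hprod := orderedCycleProd_congr (S := cycleMinsAvoiding α σ j) fun s hs =>
    cycleProd_updateRow_of_not_sameCycle (M := M) (b := b)
      (not_sameCycle_of_mem_cycleMinsAvoiding hs)
  have hsign : ∀ m, α.card - (m + 1) = (α.erase j).card - m := by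
    intro m
    rw [card_erase_of_mem hj]
    omega
  rw [rdetTerm, hprod, cycleProd_of_fixed hσ, Matrix.updateRow_self, hsign,
    cycleMinsAvoiding_of_fixed hσ, minorTerm,
    ((Commute.neg_one_left (b j)).pow_left _).left_comm]

theorem rdetTerm_updateRow_mul_swap [Finite ι] (hj : j ∈ α) (hi : i ∈ α) (hij : i ≠ j)
    (hτ : τ i = i) (M : Matrix ι ι ℍ[ℝ]) (b : ι → ℍ[ℝ]) :
    rdetTerm α j (M.updateRow j b) (τ * swap j i) =
      -(b i * rdetTerm (α.erase i) j (M.updateRow j (M i)) τ) := by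
  set S := cycleMinsAvoiding (α.erase i) τ j with hS
  have hlt : S.card < (α.erase i).card := card_cycleMinsAvoiding_lt (mem_erase.mpr ⟨hij.symm, hj⟩)
  have hsign : α.card - (S.card + 1) = (α.erase i).card - (S.card + 1) + 1 := by
    rw [← card_erase_add_one hi]
    omega
  have hprod : orderedCycleProd (M.updateRow j b) (τ * swap j i) S =
      orderedCycleProd (M.updateRow j (M i)) τ S := by
    refine orderedCycleProd_congr fun s hs => ?_
    have hjs : ¬ τ.SameCycle j s := not_sameCycle_of_mem_cycleMinsAvoiding hs
    have hsi : s ≠ i := (mem_erase.mp (mem_of_mem_cycleMinsAvoiding hs)).1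
    have hjs' : ¬ (τ * swap j i).SameCycle j s := by simp [sameCycle_mul_swap_iff hτ, hjs, hsi]
    rw [cycleProd_updateRow_of_not_sameCycle hjs', cycleProd_updateRow_of_not_sameCycle hjs]
    exact cycleProd_congr
      (mul_swap_pow_apply (fun h => hjs h.symm) (not_sameCycle_of_fixed hτ hsi)) fun _ _ => rfl
  rw [rdetTerm, cycleMinsAvoiding_mul_swap hτ, ← hS, hprod, cycleProd_mul_swap hij hτ, hsign,
    rdetTerm, ← hS, pow_succ, mul_neg_one, neg_mul, mul_assoc,
    ((Commute.neg_one_left (b i)).pow_left _).left_comm]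

theorem rdetOn_updateRow [Finite ι] (hj : j ∈ α) (M : Matrix ι ι ℍ[ℝ]) (b : ι → ℍ[ℝ]) :
    rdetOn α j (M.updateRow j b) = b j * minorOn (α.erase j) M -
      ∑ i ∈ α.erase j, b i * rdetOn (α.erase i) j (M.updateRow j (M i)) := by
  rw [rdetOn, sum_permsOfFinset_eq_sum_mul_swap hj, ← add_sum_erase _ _ hj, sub_eq_add_neg,
    ← sum_neg_distrib]
  congr 1
  · rw [minorOn, mul_sum]
    refine sum_congr rfl fun σ hσ => ?_
    rw [swap_self, ← Perm.one_def, mul_one,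
      rdetTerm_updateRow_of_fixed hj (mem_permsOfFinset_erase.mp hσ).2]
  · refine sum_congr rfl fun i hi => ?_
    obtain ⟨hij, hi⟩ := mem_erase.mp hi
    rw [rdetOn, mul_sum, ← sum_neg_distrib]
    exact sum_congr rfl fun τ hτ =>
      rdetTerm_updateRow_mul_swap hj hi hij (mem_permsOfFinset_erase.mp hτ).2 M b

theorem cycleMins_eq_insert (hσ : σ ∈ permsOfFinset α) (h : α.Nonempty) :
    cycleMins α σ = insert (α.min' h) (cycleMinsAvoiding α σ (α.min' h)) := by
  ext s
  simp only [mem_insert, mem_cycleMinsAvoiding, mem_cycleMins]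
  constructor
  · rintro ⟨hs, hmin⟩
    rw [or_iff_not_imp_right]
    intro hsm
    have hcycle : σ.SameCycle (α.min' h) s := by tauto
    exact le_antisymm (hmin _ hcycle.symm) (α.min'_le s hs)
  · rintro (rfl | hs)
    · exact ⟨α.min'_mem h, fun t ht => α.min'_le t (mem_of_sameCycle hσ ht (α.min'_mem h))⟩
    · exact hs.1

theorem minorOn_eq_rdetOn_min' (h : α.Nonempty) (M : Matrix ι ι ℍ[ℝ]) :
    minorOn α M = rdetOn α (α.min' h) M := by
  refine sum_congr rfl fun σ hσ => ?_
  set S := cycleMinsAvoiding α σ (α.min' h)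
  have hnot : α.min' h ∉ S := fun hm =>
    not_sameCycle_of_mem_cycleMinsAvoiding hm (SameCycle.refl σ _)
  have hle : ∀ s ∈ S, α.min' h ≤ s := fun s hs =>
    α.min'_le s (mem_of_mem_cycleMinsAvoiding hs)
  rw [minorTerm, cycleMins_eq_insert hσ h, card_insert_of_notMem hnot, orderedCycleProd,
    sort_insert _ hle hnot, List.map_cons, List.prod_cons]
  rfl

theorem minorOn_empty (M : Matrix ι ι ℍ[ℝ]) : minorOn ∅ M = 1 := by
  have hperms : permsOfFinset (∅ : Finset ι) = {1} := rfl
  simp [minorOn, minorTerm, orderedCycleProd, cycleMins, hperms]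

end PermDeterminants

section Principal

variable {ι : Type*} [LinearOrder ι] {α : Finset ι}

theorem ofSubtype_pow_apply (σ : Perm α) (n : ℕ) (s : α) :
    (ofSubtype σ ^ n) (s : ι) = (σ ^ n) s := by
  rw [← map_pow, ofSubtype_apply_coe]

theorem sameCycle_ofSubtype_iff (σ : Perm α) (s t : α) :
    (ofSubtype σ).SameCycle (s : ι) t ↔ σ.SameCycle s t := by
  simp only [SameCycle, ← map_zpow, ofSubtype_apply_coe, Subtype.ext_iff]

theorem ofSubtype_mem_permsOfFinset (σ : Perm α) : ofSubtype σ ∈ permsOfFinset α :=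
  mem_perms_of_finset_iff.mpr fun hs => by_contra fun h => hs (ofSubtype_apply_of_not_mem σ h)

theorem cycleProd_principal (M : Matrix ι ι ℍ[ℝ]) (σ : Perm α) (s : α) :
    cycleProd (principal M α) σ s = cycleProd M (ofSubtype σ) s := by
  have hp : Function.minimalPeriod σ s = Function.minimalPeriod (ofSubtype σ) (s : ι) :=
    minimalPeriod_congr fun n => by rw [ofSubtype_pow_apply, Subtype.ext_iff]
  simp only [cycleProd, hp, ofSubtype_pow_apply]
  rfl

theorem map_coe_leaders (σ : Perm α) (j : α) :
    (leaders σ j).map (fun s : α => (s : ι)) =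
      (cycleMinsAvoiding α (ofSubtype σ) j).sort (· ≤ ·) := by
  refine (map_sort (Function.Embedding.subtype (· ∈ α)) _ (· ≤ ·) (· ≤ ·)
    fun _ _ _ _ => Iff.rfl).trans (congrArg (sort · (· ≤ ·)) ?_)
  ext s
  simp only [mem_map, mem_filter, mem_univ, true_and, Function.Embedding.subtype_apply,
    mem_cycleMinsAvoiding, mem_cycleMins]
  constructor
  · rintro ⟨s, ⟨hjs, hmin⟩, rfl⟩
    refine ⟨⟨s.2, fun t ht => ?_⟩, by rwa [sameCycle_ofSubtype_iff]⟩
    have htα : t ∈ α := mem_of_sameCycle (ofSubtype_mem_permsOfFinset σ) ht s.2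
    exact hmin ⟨t, htα⟩ ((sameCycle_ofSubtype_iff σ s ⟨t, htα⟩).mp ht)
  · rintro ⟨⟨hs, hmin⟩, hjs⟩
    exact ⟨⟨s, hs⟩, ⟨fun h => hjs ((sameCycle_ofSubtype_iff σ j ⟨s, hs⟩).mpr h), fun t ht =>
      hmin t ((sameCycle_ofSubtype_iff σ ⟨s, hs⟩ t).mpr ht)⟩, rfl⟩

theorem rdet_principal (j : α) (M : Matrix ι ι ℍ[ℝ]) :
    rdet j (principal M α) = rdetOn α j M := by
  rw [rdet, rdetOn, ← sum_perm_ofSubtype]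
  refine sum_congr rfl fun σ _ => ?_
  have hlen : (leaders σ j).length = (cycleMinsAvoiding α (ofSubtype σ) j).card := by
    rw [← length_sort (· ≤ ·), ← map_coe_leaders, List.length_map]
  have hprod : ((leaders σ j).map (cycleProd (principal M α) σ)).prod =
      orderedCycleProd M (ofSubtype σ) (cycleMinsAvoiding α (ofSubtype σ) j) := by
    rw [orderedCycleProd, ← map_coe_leaders, List.map_map]
    exact congrArg List.prod (List.map_congr_left fun s _ => cycleProd_principal M σ s)
  rw [rdetTerm, hlen, hprod, cycleProd_principal, Fintype.card_coe]

theorem hdet_principal (α : Finset ι) (M : Matrix ι ι ℍ[ℝ]) :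
    hdet (principal M α) = minorOn α M := by
  rcases α.eq_empty_or_nonempty with rfl | h
  · rw [hdet, dif_neg (by simp), minorOn_empty]
  · have huniv : (univ : Finset α).Nonempty := univ_nonempty_iff.mpr h.to_subtype
    have hmin : ((univ.min' huniv : α) : ι) = α.min' h :=
      le_antisymm (univ.min'_le (⟨α.min' h, α.min'_mem h⟩ : α) (mem_univ _))
        (α.min'_le _ (Subtype.coe_prop _))
    rw [hdet, dif_pos huniv, rdet_principal, hmin, minorOn_eq_rdetOn_min']

end Principal

section ColumnDeterminants

variable {ι : Type*} [Fintype ι] [LinearOrder ι]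

theorem star_list_prod {R : Type*} [Monoid R] [StarMul R] (l : List R) :
    star l.prod = (l.reverse.map star).prod := by
  induction l with
  | nil => simp
  | cons a l ih => simp [ih]

theorem inv_pow_apply_eq_pow_sub {κ : Type*} {σ : Perm κ} {s : κ} {n : ℕ}
    (hn : n ≤ Function.minimalPeriod σ s) :
    (σ⁻¹ ^ n) s = (σ ^ (Function.minimalPeriod σ s - n)) s := by
  rw [inv_pow, Perm.inv_eq_iff_eq, ← Perm.mul_apply, ← pow_add, Nat.add_sub_cancel' hn,
    pow_minimalPeriod_apply]

theorem star_cycleProd_conjTranspose {κ : Type*} (M : Matrix κ κ ℍ[ℝ]) (σ : Perm κ) (s : κ) :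
    star (cycleProd Mᴴ σ s) = cycleProd M σ⁻¹ s := by
  have hp : Function.minimalPeriod (σ⁻¹ : Perm κ) s = Function.minimalPeriod σ s :=
    minimalPeriod_congr fun n => by rw [inv_pow, Perm.inv_eq_iff_eq, eq_comm]
  rw [cycleProd, star_list_prod, cycleProd, hp]
  congr 1
  refine List.ext_getElem (by simp) fun n _ hn => ?_
  rw [List.length_map, List.length_range] at hn
  simp only [List.getElem_map, List.getElem_reverse, List.length_map, List.length_range,
    List.getElem_range, Matrix.conjTranspose_apply, star_star]
  rw [inv_pow_apply_eq_pow_sub hn.le, inv_pow_apply_eq_pow_sub hn]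
  congr 3 <;> omega

theorem leaders_inv (σ : Perm ι) (j : ι) : leaders σ⁻¹ j = leaders σ j := by
  simp only [leaders, sameCycle_inv]

theorem cdet_eq_star_rdet_conjTranspose (M : Matrix ι ι ℍ[ℝ]) (j : ι) :
    cdet j M = star (rdet j Mᴴ) := by
  rw [cdet, rdet, star_sum]
  refine Fintype.sum_equiv (Equiv.inv (Perm ι)) _ _ fun σ => ?_
  have hprod : star ((leaders σ j).map (cycleProd Mᴴ σ⁻¹)).prod =
      ((leaders σ j).reverse.map (cycleProd M σ)).prod := by
    rw [star_list_prod, ← List.map_reverse, List.map_map]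
    congr 2
    ext1 s
    rw [Function.comp_apply, star_cycleProd_conjTranspose, inv_inv]
  rw [Equiv.inv_apply, leaders_inv, star_mul, star_mul, hprod, star_cycleProd_conjTranspose,
    inv_inv, star_pow, star_neg, star_one, ((Commute.neg_one_left _).pow_left _).eq]

theorem cdetSum_eq_star_rdetSum (q : ℕ) {B : Matrix ι ι ℍ[ℝ]} (hB : B.IsHermitian) (i : ι)
    (c : ι → ℍ[ℝ]) : cdetSum q B i c = star (rdetSum q B i (star c)) := by
  rw [cdetSum, rdetSum, star_sum]
  refine sum_congr rfl fun β _ => ?_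
  have hrow : (B.updateCol i c)ᴴ = B.updateRow i (star c) := by
    rw [← Matrix.updateRow_conjTranspose, hB.eq]
  rw [cdet_eq_star_rdet_conjTranspose, ← hrow]
  rfl

end ColumnDeterminants

section Cofactors

variable {ι : Type*} [LinearOrder ι] {α β : Finset ι} {B : Matrix ι ι ℍ[ℝ]} {i j : ι}

/-- The matrix of cofactors of the principal submatrix on `α`, extended by zero to the ambient
index type. Its `(i, j)` entry is the right coefficient of the `i`-th entry of the `j`-th row in
the `j`-th row determinant, so it plays the role of the adjugate. -/
noncomputable def cofactorOn (α : Finset ι) (B : Matrix ι ι ℍ[ℝ]) : Matrix ι ι ℍ[ℝ] :=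
  Matrix.of fun i j => if i ∈ α ∧ j ∈ α then
    if i = j then minorOn (α.erase j) B else -rdetOn (α.erase i) j (B.updateRow j (B i)) else 0

theorem cofactorOn_apply_self (hi : i ∈ α) : cofactorOn α B i i = minorOn (α.erase i) B := by
  simp [cofactorOn, hi]

theorem cofactorOn_apply_of_ne (hi : i ∈ α) (hj : j ∈ α) (hij : i ≠ j) :
    cofactorOn α B i j = -rdetOn (α.erase i) j (B.updateRow j (B i)) := by
  simp [cofactorOn, hi, hj, hij]

theorem cofactorOn_apply_of_notMem_left (hi : i ∉ α) (j : ι) : cofactorOn α B i j = 0 := by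
  simp [cofactorOn, hi]

theorem cofactorOn_apply_of_notMem_right (i : ι) (hj : j ∉ α) : cofactorOn α B i j = 0 := by
  simp [cofactorOn, hj]

theorem continuous_rdetOn (α : Finset ι) (j : ι) : Continuous (rdetOn α j) := by
  have hcycle : ∀ (σ : Perm ι) (s : ι), Continuous fun M => cycleProd M σ s := fun σ s =>
    continuous_list_prod _ fun n _ => continuous_id.matrix_elem _ _
  exact continuous_finsetSum _ fun σ _ => continuous_const.mul
    ((hcycle σ j).mul (continuous_list_prod _ fun s _ => hcycle σ s))

variable [Fintype ι]

theorem vecMul_cofactorOn_of_notMem (b : ι → ℍ[ℝ]) (hj : j ∉ α) : (b ᵥ* cofactorOn α B) j = 0 :=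
  sum_eq_zero fun i _ => by simp only [cofactorOn_apply_of_notMem_right i hj, mul_zero]

theorem rdetOn_updateRow_eq_vecMul (hj : j ∈ α) (b : ι → ℍ[ℝ]) :
    rdetOn α j (B.updateRow j b) = (b ᵥ* cofactorOn α B) j := by
  have hsupp : ∀ i ∈ univ, i ∉ α → b i * cofactorOn α B i j = 0 := fun i _ hi => by
    rw [cofactorOn_apply_of_notMem_left hi, mul_zero]
  rw [rdetOn_updateRow hj, Matrix.vecMul, dotProduct, ← sum_subset (subset_univ α) hsupp,
    ← add_sum_erase _ _ hj, cofactorOn_apply_self hj, sub_eq_add_neg, ← sum_neg_distrib]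
  congr 1
  refine sum_congr rfl fun i hi => ?_
  obtain ⟨hij, hi⟩ := mem_erase.mp hi
  rw [cofactorOn_apply_of_ne hi hj hij, mul_neg]

theorem rdetOn_eq_mul_cofactorOn_apply (hj : j ∈ α) :
    rdetOn α j B = (B * cofactorOn α B) j j := by
  have h := rdetOn_updateRow_eq_vecMul (B := B) hj (B j)
  rwa [Matrix.updateRow_eq_self] at h

theorem cofactorOn_insert_left_apply (hi : i ∉ β) (j : ι) : cofactorOn (insert i β) B i j =
    (if i = j then minorOn β B else 0) - (B * cofactorOn β B) i j := by
  change _ = _ - (B i ᵥ* cofactorOn β B) j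
  split_ifs with hij
  · subst hij
    rw [cofactorOn_apply_self (mem_insert_self i β), erase_insert hi,
      vecMul_cofactorOn_of_notMem _ hi, sub_zero]
  · by_cases hj : j ∈ β
    · rw [cofactorOn_apply_of_ne (mem_insert_self i β) (mem_insert_of_mem hj) hij,
        erase_insert hi, rdetOn_updateRow_eq_vecMul hj, zero_sub]
    · rw [cofactorOn_apply_of_notMem_right i (by simp [hj, Ne.symm hij]),
        vecMul_cofactorOn_of_notMem _ hj, sub_zero]

end Cofactors

section HermitianMinors

theorem commute_of_isSelfAdjoint {x : ℍ[ℝ]} (hx : IsSelfAdjoint x) (y : ℍ[ℝ]) : Commute x y := by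
  rw [Quaternion.star_eq_self.mp hx]
  exact Quaternion.coe_commute _ _

section MatrixEntries

variable {R ι : Type*} [Fintype ι] {B C D : Matrix ι ι R} {i j : ι}

theorem star_mul_apply_of_isHermitian [Semiring R] [StarRing R] (hB : B.IsHermitian)
    (hC : C.IsHermitian) (i j : ι) : star ((B * C) i j) = (C * B) j i := by
  rw [← Matrix.conjTranspose_apply, Matrix.conjTranspose_mul, hB.eq, hC.eq]

variable [Ring R] [DecidableEq ι] {m : R}

theorem mul_apply_of_col_eq (h : ∀ k, C k j = (if k = j then m else 0) - D k j) (i : ι) :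
    (B * C) i j = B i j * m - (B * D) i j := by
  simp [Matrix.mul_apply, h, mul_sub]

theorem mul_apply_of_row_eq (h : ∀ k, C i k = (if i = k then m else 0) - D i k) (j : ι) :
    (C * B) i j = m * B i j - (D * B) i j := by
  simp [Matrix.mul_apply, h, sub_mul]

end MatrixEntries

variable {ι : Type*} [Fintype ι] [LinearOrder ι] {α β : Finset ι} {B : Matrix ι ι ℍ[ℝ]} {i j : ι}

/-- On the principal submatrix of `B` with index set `α` the Hermitian determinant theory holds:
the minor is real and the cofactor matrix is a Hermitian adjugate. -/
structure IsAdjugateOn (B : Matrix ι ι ℍ[ℝ]) (α : Finset ι) : Prop where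
  isSelfAdjoint_minorOn : IsSelfAdjoint (minorOn α B)
  isHermitian_cofactorOn : (cofactorOn α B).IsHermitian
  cofactorOn_mul_apply : ∀ i, ∀ j ∈ α,
    (cofactorOn α B * B) i j = if i = j then minorOn α B else 0

theorem cofactorOn_insert_right_apply (hB : B.IsHermitian) (hβ : IsAdjugateOn B β) (hj : j ∉ β)
    (hH : (cofactorOn (insert j β) B).IsHermitian) (i : ι) : cofactorOn (insert j β) B i j =
      (if i = j then minorOn β B else 0) - (cofactorOn β B * B) i j := by
  rw [← hH.apply i j, cofactorOn_insert_left_apply hj, star_sub,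
    star_mul_apply_of_isHermitian hB hβ.isHermitian_cofactorOn, apply_ite star,
    hβ.isSelfAdjoint_minorOn.star_eq, star_zero]
  simp only [eq_comm]

theorem cofactorOn_insert_insert_apply (hB : B.IsHermitian) (hβ : IsAdjugateOn B β)
    (hjβ : IsAdjugateOn B (insert j β)) (hij : i ≠ j) (hi : i ∉ β) (hj : j ∉ β) :
    cofactorOn (insert i (insert j β)) B i j =
      (B * (cofactorOn β B * B)) i j - B i j * minorOn β B := by
  rw [cofactorOn_insert_left_apply (by simp [hij, hi]), if_neg hij,
    mul_apply_of_col_eq (cofactorOn_insert_right_apply hB hβ hj hjβ.isHermitian_cofactorOn),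
    zero_sub, neg_sub]

theorem isHermitian_mul_cofactorOn_mul (hB : B.IsHermitian) (hβ : IsAdjugateOn B β) :
    (B * (cofactorOn β B * B)).IsHermitian := by
  rw [Matrix.IsHermitian, Matrix.conjTranspose_mul, Matrix.conjTranspose_mul, hB.eq,
    hβ.isHermitian_cofactorOn.eq, Matrix.mul_assoc]

theorem isHermitian_cofactorOn_of_ssubset (hB : B.IsHermitian)
    (hα : ∀ β, β ⊂ α → IsAdjugateOn B β) : (cofactorOn α B).IsHermitian := by
  refine Matrix.IsHermitian.ext fun i j => ?_
  by_cases hi : i ∈ α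
  swap
  · rw [cofactorOn_apply_of_notMem_left hi, cofactorOn_apply_of_notMem_right j hi, star_zero]
  by_cases hj : j ∈ α
  swap
  · rw [cofactorOn_apply_of_notMem_left hj, cofactorOn_apply_of_notMem_right i hj, star_zero]
  rcases eq_or_ne i j with rfl | hij
  · rw [cofactorOn_apply_self hi]
    exact (hα _ (erase_ssubset hi)).isSelfAdjoint_minorOn
  obtain ⟨β, hiβ, hjβ, rfl⟩ : ∃ β, i ∉ β ∧ j ∉ β ∧ α = insert i (insert j β) :=
    ⟨(α.erase i).erase j, by simp, by simp, by
      rw [insert_erase (mem_erase.mpr ⟨hij.symm, hj⟩), insert_erase hi]⟩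
  have hss : ∀ k l, k ∉ β → k ≠ l → insert l β ⊂ insert k (insert l β) := fun k l hk hkl =>
    ssubset_insert (by simp [hk, hkl])
  have hβ : IsAdjugateOn B β := hα β ((ssubset_insert hjβ).trans (hss i j hiβ hij))
  have hjβ' : IsAdjugateOn B (insert j β) := hα _ (hss i j hiβ hij)
  have hiβ' : IsAdjugateOn B (insert i β) :=
    hα _ (insert_comm i j β ▸ hss j i hjβ hij.symm)
  rw [cofactorOn_insert_insert_apply hB hβ hjβ' hij hiβ hjβ, insert_comm,
    cofactorOn_insert_insert_apply hB hβ hiβ' hij.symm hjβ hiβ, star_sub, star_mul,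
    (isHermitian_mul_cofactorOn_mul hB hβ).apply, hB.apply, hβ.isSelfAdjoint_minorOn.star_eq,
    (commute_of_isSelfAdjoint hβ.isSelfAdjoint_minorOn _).eq]

theorem isSelfAdjoint_rdetOn_of_ssubset (hB : B.IsHermitian)
    (hα : ∀ β, β ⊂ α → IsAdjugateOn B β) (hj : j ∈ α) : IsSelfAdjoint (rdetOn α j B) := by
  obtain ⟨β, hjβ, rfl⟩ : ∃ β, j ∉ β ∧ α = insert j β :=
    ⟨α.erase j, notMem_erase j α, (insert_erase hj).symm⟩
  have hβ : IsAdjugateOn B β := hα β (ssubset_insert hjβ)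
  rw [rdetOn_eq_mul_cofactorOn_apply hj, mul_apply_of_col_eq (cofactorOn_insert_right_apply hB hβ
    hjβ (isHermitian_cofactorOn_of_ssubset hB hα)), IsSelfAdjoint, star_sub, star_mul, hB.apply,
    (isHermitian_mul_cofactorOn_mul hB hβ).apply, hβ.isSelfAdjoint_minorOn.star_eq,
    (commute_of_isSelfAdjoint hβ.isSelfAdjoint_minorOn _).eq]

theorem cofactorOn_mul_apply_eq_rdetOn_of_ssubset (hB : B.IsHermitian)
    (hα : ∀ β, β ⊂ α → IsAdjugateOn B β) (i : ι) (hj : j ∈ α) :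
    (cofactorOn α B * B) i j = if i = j then rdetOn α j B else 0 := by
  split_ifs with hij
  · subst hij
    rw [← star_mul_apply_of_isHermitian hB (isHermitian_cofactorOn_of_ssubset hB hα),
      ← rdetOn_eq_mul_cofactorOn_apply hj, (isSelfAdjoint_rdetOn_of_ssubset hB hα hj).star_eq]
  by_cases hi : i ∈ α
  · have hβ : IsAdjugateOn B (α.erase i) := hα _ (erase_ssubset hi)
    have hrow := cofactorOn_insert_left_apply (B := B) (notMem_erase i α)
    have hcol : ∀ k, (cofactorOn (α.erase i) B * B) k j =
        (if k = j then minorOn (α.erase i) B else 0) - (0 : Matrix ι ι ℍ[ℝ]) k j := fun k => by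
      rw [hβ.cofactorOn_mul_apply k j (mem_erase.mpr ⟨Ne.symm hij, hj⟩), Matrix.zero_apply,
        sub_zero]
    rw [insert_erase hi] at hrow
    rw [mul_apply_of_row_eq hrow, Matrix.mul_assoc, mul_apply_of_col_eq hcol,
      (commute_of_isSelfAdjoint hβ.isSelfAdjoint_minorOn _).eq, Matrix.mul_zero,
      Matrix.zero_apply, sub_zero, sub_self]
  · exact sum_eq_zero fun k _ => by simp only [cofactorOn_apply_of_notMem_left hi, zero_mul]

theorem rdetOn_eq_rdetOn_of_apply_ne_zero (hB : B.IsHermitian)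
    (hα : ∀ β, β ⊂ α → IsAdjugateOn B β) (hi : i ∈ α) (hj : j ∈ α) (hij : B i j ≠ 0) :
    rdetOn α i B = rdetOn α j B := by
  have hcof := isHermitian_cofactorOn_of_ssubset hB hα
  have hcol : ∀ k, (cofactorOn α B * B) k j =
      (if k = j then rdetOn α j B else 0) - (0 : Matrix ι ι ℍ[ℝ]) k j := fun k => by
    rw [cofactorOn_mul_apply_eq_rdetOn_of_ssubset hB hα k hj, Matrix.zero_apply, sub_zero]
  have hrow : ∀ k, (B * cofactorOn α B) i k =
      (if i = k then rdetOn α i B else 0) - (0 : Matrix ι ι ℍ[ℝ]) i k := fun k => by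
    rw [← star_mul_apply_of_isHermitian hcof hB,
      cofactorOn_mul_apply_eq_rdetOn_of_ssubset hB hα k hi, apply_ite star,
      (isSelfAdjoint_rdetOn_of_ssubset hB hα hi).star_eq, star_zero, Matrix.zero_apply, sub_zero]
    simp only [eq_comm]
  have hcomm : rdetOn α i B * B i j = rdetOn α j B * B i j := by
    have h := mul_apply_of_row_eq (B := B) hrow j
    rw [Matrix.mul_assoc, mul_apply_of_col_eq hcol] at h
    simpa [(commute_of_isSelfAdjoint (isSelfAdjoint_rdetOn_of_ssubset hB hα hj) _).eq]
      using h.symm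
  exact mul_right_cancel₀ hij hcomm

-- Where `B i j = 0`, perturb that entry and let the perturbation tend to zero.
theorem rdetOn_eq_rdetOn_of_ssubset (hB : B.IsHermitian)
    (hα : ∀ β, β ⊂ α → ∀ C : Matrix ι ι ℍ[ℝ], C.IsHermitian → IsAdjugateOn C β)
    (hi : i ∈ α) (hj : j ∈ α) : rdetOn α i B = rdetOn α j B := by
  by_cases hij : B i j = 0
  swap
  · exact rdetOn_eq_rdetOn_of_apply_ne_zero hB (fun β hβ => hα β hβ B hB) hi hj hij
  rcases eq_or_ne i j with rfl | hne
  · rfl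
  let E : Matrix ι ι ℍ[ℝ] := Matrix.single i j 1 + Matrix.single j i 1
  have hE : E.IsHermitian := by
    rw [Matrix.IsHermitian, Matrix.conjTranspose_add, Matrix.conjTranspose_single,
      Matrix.conjTranspose_single, star_one, add_comm]
  let P : ℝ → Matrix ι ι ℍ[ℝ] := fun t => B + t • E
  have hP : ∀ t, (P t).IsHermitian := fun t => hB.add (by
    ext1 k l
    rw [Matrix.conjTranspose_apply, Matrix.smul_apply, Matrix.smul_apply, Quaternion.star_smul,
      hE.apply])
  have hPij : ∀ t, P t i j = t := fun t => by
    simp [P, E, hij, hne, ← Quaternion.coe_mul_eq_smul]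
  have hPcont : Continuous P := by fun_prop
  have heq : Set.EqOn (fun t => rdetOn α i (P t)) (fun t => rdetOn α j (P t)) {0}ᶜ := fun t ht =>
    rdetOn_eq_rdetOn_of_apply_ne_zero (hP t) (fun β hβ => hα β hβ _ (hP t)) hi hj (by
      rw [hPij]
      exact fun h => ht (Quaternion.coe_injective h))
  have := congrFun (Continuous.ext_on (dense_compl_singleton 0)
    ((continuous_rdetOn α i).comp hPcont) ((continuous_rdetOn α j).comp hPcont) heq) 0
  simpa [P] using this

theorem isAdjugateOn_of_isHermitian (hB : B.IsHermitian) (α : Finset ι) : IsAdjugateOn B α := by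
  induction α using Finset.strongInduction generalizing B with
  | H α ih =>
    have hα : ∀ β, β ⊂ α → IsAdjugateOn B β := fun β hβ => ih β hβ hB
    have hminor : ∀ j ∈ α, rdetOn α j B = minorOn α B := fun j hj => by
      rw [minorOn_eq_rdetOn_min' ⟨j, hj⟩]
      exact rdetOn_eq_rdetOn_of_ssubset hB (fun β hβ C hC => ih β hβ hC) hj (α.min'_mem _)
    refine ⟨?_, isHermitian_cofactorOn_of_ssubset hB hα, fun i j hj => ?_⟩
    · rcases α.eq_empty_or_nonempty with rfl | ⟨j, hj⟩
      · rw [minorOn_empty]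
        exact IsSelfAdjoint.one _
      · rw [← hminor j hj]
        exact isSelfAdjoint_rdetOn_of_ssubset hB hα hj
    · rw [cofactorOn_mul_apply_eq_rdetOn_of_ssubset hB hα i hj, hminor j hj]

end HermitianMinors

section RealTrace

theorem re_sum {κ : Type*} (s : Finset κ) (f : κ → ℍ[ℝ]) :
    (∑ i ∈ s, f i).re = ∑ i ∈ s, (f i).re :=
  map_sum (QuaternionAlgebra.reₗ _ _ _) f s

variable {ι κ : Type*} [Fintype ι] [Fintype κ]

/-- The real part of the trace. Unlike the quaternionic trace it is invariant under cyclic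
permutation of a product. -/
def reTrace (M : Matrix ι ι ℍ[ℝ]) : ℝ := ∑ i, (M i i).re

theorem reTrace_mul_comm (M : Matrix ι κ ℍ[ℝ]) (N : Matrix κ ι ℍ[ℝ]) :
    reTrace (M * N) = reTrace (N * M) := by
  have hre : ∀ x y : ℍ[ℝ], (x * y).re = (y * x).re := fun x y => by
    rw [Quaternion.re_mul, Quaternion.re_mul]
    ring
  simp only [reTrace, Matrix.mul_apply, re_sum]
  rw [sum_comm]
  exact sum_congr rfl fun _ _ => sum_congr rfl fun _ _ => hre _ _

theorem reTrace_smul (a : ℝ) (M : Matrix ι ι ℍ[ℝ]) : reTrace (a • M) = a * reTrace M := by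
  simp [reTrace, mul_sum]

theorem reTrace_one [DecidableEq ι] : reTrace (1 : Matrix ι ι ℍ[ℝ]) = Fintype.card ι := by
  simp [reTrace]

theorem reTrace_sum {μ : Type*} (s : Finset μ) (M : μ → Matrix ι ι ℍ[ℝ]) :
    reTrace (∑ k ∈ s, M k) = ∑ k ∈ s, reTrace (M k) := by
  simp only [reTrace, Matrix.sum_apply, re_sum]
  exact sum_comm

end RealTrace

section AdjugateSum

variable {ι : Type*} [Fintype ι] [LinearOrder ι]

theorem IsAdjugateOn.mul_cofactorOn_apply {B : Matrix ι ι ℍ[ℝ]} {α : Finset ι}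
    (hα : IsAdjugateOn B α) (hB : B.IsHermitian) {i : ι} (hi : i ∈ α) (j : ι) :
    (B * cofactorOn α B) i j = if i = j then minorOn α B else 0 := by
  rw [← star_mul_apply_of_isHermitian hα.isHermitian_cofactorOn hB,
    hα.cofactorOn_mul_apply j i hi, apply_ite star, hα.isSelfAdjoint_minorOn.star_eq, star_zero]
  simp only [eq_comm]

theorem minorSum_eq_sum_minorOn (q : ℕ) (B : Matrix ι ι ℍ[ℝ]) :
    minorSum q B = ∑ α ∈ univ.powersetCard q, minorOn α B := by
  rw [minorSum, sum_subtype _ (fun α => mem_powersetCard_univ)]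
  exact sum_congr rfl fun α _ => hdet_principal _ _

theorem minorSum_zero (B : Matrix ι ι ℍ[ℝ]) : minorSum 0 B = 1 := by
  rw [minorSum_eq_sum_minorOn, powersetCard_zero, sum_singleton, minorOn_empty]

theorem minorSum_eq_coe_re {B : Matrix ι ι ℍ[ℝ]} (hB : B.IsHermitian) (q : ℕ) :
    minorSum q B = ((minorSum q B).re : ℍ[ℝ]) := by
  rw [← Quaternion.star_eq_self, minorSum_eq_sum_minorOn, star_sum]
  exact sum_congr rfl fun α _ => (isAdjugateOn_of_isHermitian hB α).isSelfAdjoint_minorOn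

/-- The sum of the cofactor matrices of the principal submatrices of order `q`. For an `n × n`
Hermitian matrix `B` it stands for the coefficient of `t ^ (n - q)` in the adjugate of
`t • 1 + B`. -/
noncomputable def adjugateSum (q : ℕ) (B : Matrix ι ι ℍ[ℝ]) : Matrix ι ι ℍ[ℝ] :=
  ∑ α ∈ univ.powersetCard q, cofactorOn α B

theorem adjugateSum_zero (B : Matrix ι ι ℍ[ℝ]) : adjugateSum 0 B = 0 := by
  rw [adjugateSum, powersetCard_zero, sum_singleton]
  ext1 i j
  exact cofactorOn_apply_of_notMem_left (notMem_empty i) j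

theorem adjugateSum_eq_zero_of_card_lt {q : ℕ} (hq : Fintype.card ι < q) (B : Matrix ι ι ℍ[ℝ]) :
    adjugateSum q B = 0 := by
  rw [adjugateSum, powersetCard_eq_empty.mpr hq, sum_empty]

theorem rdetSum_eq_vecMul_adjugateSum (q : ℕ) (B : Matrix ι ι ℍ[ℝ]) (j : ι) (b : ι → ℍ[ℝ]) :
    rdetSum q B j b = (b ᵥ* adjugateSum q B) j := by
  have hsum : (b ᵥ* adjugateSum q B) j =
      ∑ α ∈ univ.powersetCard q, (b ᵥ* cofactorOn α B) j := by
    simp only [Matrix.vecMul, dotProduct, adjugateSum, Matrix.sum_apply, mul_sum]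
    exact sum_comm
  have hsupp : ∀ α : Finset ι, (b ᵥ* cofactorOn α B) j ≠ 0 → j ∈ α := fun α h =>
    by_contra fun hj => h (vecMul_cofactorOn_of_notMem b hj)
  rw [hsum, ← sum_filter_of_ne fun α _ => hsupp α, rdetSum,
    sum_subtype _ (p := fun α : Finset ι => α.card = q ∧ j ∈ α) fun α => by
      rw [mem_filter, mem_powersetCard_univ]]
  refine sum_congr rfl fun α _ => ?_
  rw [rdet_principal, rdetOn_updateRow_eq_vecMul α.2.2]

variable {B : Matrix ι ι ℍ[ℝ]}

theorem adjugateSum_succ_apply (q : ℕ) (B : Matrix ι ι ℍ[ℝ]) (i j : ι) :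
    adjugateSum (q + 1) B i j =
      ∑ β ∈ univ.powersetCard q with i ∉ β, cofactorOn (insert i β) B i j := by
  have hsupp : ∀ α : Finset ι, cofactorOn α B i j ≠ 0 → i ∈ α := fun α h =>
    by_contra fun hi => h (cofactorOn_apply_of_notMem_left hi j)
  rw [adjugateSum, Matrix.sum_apply, ← sum_filter_of_ne fun α _ => hsupp α]
  refine sum_nbij' (fun α => α.erase i) (insert i) ?_ ?_ ?_ ?_ ?_ <;>
    simp only [mem_filter, mem_powersetCard_univ, and_imp]
  · exact fun α hα hi => ⟨by rw [card_erase_of_mem hi, hα, Nat.add_sub_cancel], notMem_erase i α⟩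
  · exact fun β hβ hi => ⟨by rw [card_insert_of_notMem hi, hβ], mem_insert_self i β⟩
  · exact fun α _ hi => insert_erase hi
  · exact fun β _ hi => erase_insert hi
  · exact fun α _ hi => by rw [insert_erase hi]

theorem adjugateSum_succ (hB : B.IsHermitian) (q : ℕ) :
    adjugateSum (q + 1) B = (minorSum q B).re • 1 - B * adjugateSum q B := by
  ext1 i j
  let f : Finset ι → ℍ[ℝ] := fun β =>
    (if i = j then minorOn β B else 0) - (B * cofactorOn β B) i j
  have hmem : ∀ β, f β ≠ 0 → i ∉ β := fun β h hi => h (by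
    simp only [f, (isAdjugateOn_of_isHermitian hB β).mul_cofactorOn_apply hB hi, sub_self])
  calc adjugateSum (q + 1) B i j = ∑ β ∈ univ.powersetCard q with i ∉ β, f β := by
        rw [adjugateSum_succ_apply]
        exact sum_congr rfl fun β hβ => cofactorOn_insert_left_apply (mem_filter.mp hβ).2 j
    _ = ∑ β ∈ univ.powersetCard q, f β := sum_filter_of_ne fun β _ => hmem β
    _ = ((minorSum q B).re • (1 : Matrix ι ι ℍ[ℝ]) - B * adjugateSum q B) i j := by
        rw [sum_sub_distrib, Matrix.sub_apply, Matrix.smul_apply, Matrix.one_apply, smul_ite,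
          smul_zero, ← Quaternion.coe_mul_eq_smul, mul_one, ← minorSum_eq_coe_re hB,
          minorSum_eq_sum_minorOn, sum_ite_irrel, sum_const_zero, adjugateSum, Matrix.mul_sum,
          Matrix.sum_apply]

theorem commute_adjugateSum (hB : B.IsHermitian) (q : ℕ) : Commute B (adjugateSum q B) := by
  induction q with
  | zero =>
    rw [adjugateSum_zero]
    exact Commute.zero_right B
  | succ q ih =>
    rw [adjugateSum_succ hB]
    exact ((Commute.one_right B).smul_right _).sub_right ((Commute.refl B).mul_right ih)

theorem reTrace_mul_cofactorOn (hB : B.IsHermitian) (α : Finset ι) :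
    reTrace (B * cofactorOn α B) = α.card * (minorOn α B).re := by
  have hdiag : ∀ i, ((B * cofactorOn α B) i i).re = if i ∈ α then (minorOn α B).re else 0 := by
    intro i
    split_ifs with hi
    · rw [(isAdjugateOn_of_isHermitian hB α).mul_cofactorOn_apply hB hi, if_pos rfl]
    · exact congrArg QuaternionAlgebra.re (vecMul_cofactorOn_of_notMem (B i) hi)
  simp [reTrace, hdiag]

theorem reTrace_mul_adjugateSum (hB : B.IsHermitian) (q : ℕ) :
    reTrace (B * adjugateSum q B) = q * (minorSum q B).re := by
  have hre : (minorSum q B).re = ∑ α ∈ univ.powersetCard q, (minorOn α B).re := by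
    rw [minorSum_eq_sum_minorOn, re_sum]
  rw [adjugateSum, Matrix.mul_sum, reTrace_sum, hre, mul_sum]
  refine sum_congr rfl fun α hα => ?_
  rw [reTrace_mul_cofactorOn hB, mem_powersetCard_univ.mp hα]

end AdjugateSum

section ConjTransposeMulSelf

variable {ι κ : Type*} [Fintype ι] [Fintype κ] [LinearOrder ι] [LinearOrder κ]
  (A : Matrix ι κ ℍ[ℝ])

theorem minorSum_re_of_intertwine {q : ℕ}
    (h : Aᴴ * adjugateSum q (A * Aᴴ) = adjugateSum q (Aᴴ * A) * Aᴴ) :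
    (minorSum q (A * Aᴴ)).re = (minorSum q (Aᴴ * A)).re := by
  rcases Nat.eq_zero_or_pos q with rfl | hq
  · rw [minorSum_zero, minorSum_zero]
  refine mul_left_cancel₀ (Nat.cast_ne_zero.mpr hq.ne' : (q : ℝ) ≠ 0) ?_
  rw [← reTrace_mul_adjugateSum (Matrix.isHermitian_mul_conjTranspose_self A),
    ← reTrace_mul_adjugateSum (Matrix.isHermitian_conjTranspose_mul_self A), Matrix.mul_assoc,
    h, reTrace_mul_comm, Matrix.mul_assoc, reTrace_mul_comm]

theorem conjTranspose_mul_adjugateSum (q : ℕ) :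
    Aᴴ * adjugateSum q (A * Aᴴ) = adjugateSum q (Aᴴ * A) * Aᴴ := by
  induction q with
  | zero => rw [adjugateSum_zero, adjugateSum_zero, Matrix.mul_zero, Matrix.zero_mul]
  | succ q ih =>
    rw [adjugateSum_succ (Matrix.isHermitian_mul_conjTranspose_self A),
      adjugateSum_succ (Matrix.isHermitian_conjTranspose_mul_self A),
      minorSum_re_of_intertwine A ih, Matrix.mul_sub, Matrix.sub_mul, Matrix.mul_smul,
      Matrix.smul_mul, Matrix.mul_one, Matrix.one_mul, Matrix.mul_assoc A, ih]
    simp only [Matrix.mul_assoc]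

theorem minorSum_mul_conjTranspose (q : ℕ) : minorSum q (A * Aᴴ) = minorSum q (Aᴴ * A) := by
  rw [minorSum_eq_coe_re (Matrix.isHermitian_mul_conjTranspose_self A),
    minorSum_eq_coe_re (Matrix.isHermitian_conjTranspose_mul_self A),
    minorSum_re_of_intertwine A (conjTranspose_mul_adjugateSum A q)]

end ConjTransposeMulSelf

section RankOfMatrix

variable {ι κ μ : Type*}

theorem rk_mul_le_right [Fintype κ] (Y : Matrix ι κ ℍ[ℝ]) (C : Matrix κ μ ℍ[ℝ]) :
    rk (Y * C) ≤ rk C :=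
  have := FiniteDimensional.span_of_finite ℍ[ℝ] (Set.finite_range C.row)
  Submodule.finrank_mono (Submodule.span_le.mpr (Set.range_subset_iff.mpr fun i =>
    (mem_rowSpace_iff C _).mpr ⟨Y i, rfl⟩))

theorem exists_rank_factorization [Fintype ι] (A : Matrix ι κ ℍ[ℝ]) :
    ∃ (X : Matrix ι (Fin (rk A)) ℍ[ℝ]) (Y : Matrix (Fin (rk A)) κ ℍ[ℝ])
      (Z : Matrix (Fin (rk A)) ι ℍ[ℝ]), X * Y = A ∧ Z * A = Y ∧ LinearIndependent ℍ[ℝ] Y.row := by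
  have := FiniteDimensional.span_of_finite ℍ[ℝ] (Set.finite_range A.row)
  let b := Module.finBasis ℍ[ℝ] (Submodule.span ℍ[ℝ] (Set.range A.row))
  let Y : Matrix (Fin (rk A)) κ ℍ[ℝ] := Matrix.of fun l => (b l : κ → ℍ[ℝ])
  have hY : LinearIndependent ℍ[ℝ] Y.row :=
    b.linearIndependent.map' (Submodule.subtype _) (Submodule.ker_subtype _)
  have hspan : Submodule.span ℍ[ℝ] (Set.range Y.row) =
      Submodule.span ℍ[ℝ] (Set.range A.row) := by
    have h := congrArg (Submodule.map (Submodule.subtype _)) b.span_eq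
    rwa [Submodule.map_span, ← Set.range_comp, Submodule.map_subtype_top] at h
  have hX : ∀ i, ∃ c, c ᵥ* Y = A.row i := fun i =>
    (mem_rowSpace_iff Y _).mp (hspan ▸ Submodule.subset_span ⟨i, rfl⟩)
  have hZ : ∀ l, ∃ c, c ᵥ* A = Y.row l := fun l => (mem_rowSpace_iff A _).mp (b l).2
  choose X hX using hX
  choose Z hZ using hZ
  exact ⟨Matrix.of X, Y, Matrix.of Z, Matrix.ext_row hX, Matrix.ext_row hZ, hY⟩

theorem rk_conjTranspose_le [Finite ι] (A : Matrix ι κ ℍ[ℝ]) : rk Aᴴ ≤ rk A := by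
  cases nonempty_fintype ι
  obtain ⟨X, Y, _, hXY, -, -⟩ := exists_rank_factorization A
  calc rk Aᴴ = rk (Yᴴ * Xᴴ) := by rw [← Matrix.conjTranspose_mul, hXY]
    _ ≤ rk Xᴴ := rk_mul_le_right _ _
    _ ≤ Fintype.card (Fin (rk A)) := finrank_range_le_card _
    _ = rk A := Fintype.card_fin _

theorem rk_conjTranspose [Finite ι] [Finite κ] (A : Matrix ι κ ℍ[ℝ]) : rk Aᴴ = rk A := by
  refine le_antisymm (rk_conjTranspose_le A) ?_
  simpa only [Matrix.conjTranspose_conjTranspose] using rk_conjTranspose_le Aᴴ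

theorem reTrace_of_isIdempotentElem [Fintype ι] {E : Matrix ι ι ℍ[ℝ]} (hE : IsIdempotentElem E) :
    reTrace E = rk E := by
  obtain ⟨X, Y, Z, hXY, hZE, hY⟩ := exists_rank_factorization E
  have hYE : Y * E = Y := by rw [← hZE, Matrix.mul_assoc, hE.eq]
  have hYX : Y * X = 1 := by
    refine Matrix.ext_row fun l => Matrix.vecMul_injective_iff.mpr hY ?_
    have h : Y * X * Y = (1 : Matrix (Fin (rk E)) (Fin (rk E)) ℍ[ℝ]) * Y := by
      rw [Matrix.mul_assoc, hXY, hYE, Matrix.one_mul]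
    exact congrFun h l
  calc reTrace E = reTrace (X * Y) := by rw [hXY]
    _ = rk E := by rw [reTrace_mul_comm, hYX, reTrace_one, Fintype.card_fin]

end RankOfMatrix

section RankOfHermitian

variable {ι κ : Type*} [Fintype ι] [LinearOrder ι] {B : Matrix ι ι ℍ[ℝ]} {s : ℕ}

theorem exists_isGreatest_minorSum_ne_zero (B : Matrix ι ι ℍ[ℝ]) :
    ∃ s, IsGreatest {q | minorSum q B ≠ 0} s := by
  refine BddAbove.exists_isGreatest_of_nonempty ⟨Fintype.card ι, fun q hq => ?_⟩
    ⟨0, by simp [minorSum_zero]⟩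
  by_contra! hlt
  exact hq (by rw [minorSum_eq_sum_minorOn, powersetCard_eq_empty.mpr hlt, sum_empty])

theorem minorSum_eq_zero_of_lt (hs : IsGreatest {q | minorSum q B ≠ 0} s) {q : ℕ} (hq : s < q) :
    minorSum q B = 0 :=
  by_contra fun h => (hs.2 h).not_gt hq

theorem re_minorSum_ne_zero (hB : B.IsHermitian) (h : minorSum s B ≠ 0) :
    (minorSum s B).re ≠ 0 := fun h0 =>
  h (by rw [minorSum_eq_coe_re hB, h0, Quaternion.coe_zero])

theorem mul_eq_zero_of_pow_mul_eq_zero (hB : B.IsHermitian) {Y : Matrix ι κ ℍ[ℝ]} (n : ℕ)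
    (h : B ^ n * Y = 0) : B * Y = 0 := by
  induction n generalizing Y with
  | zero => rw [pow_zero, Matrix.one_mul] at h; rw [h, Matrix.mul_zero]
  | succ n ih =>
    rw [pow_succ, Matrix.mul_assoc] at h
    apply mul_eq_zero_of_conjTranspose_mul
    rw [hB.eq, Matrix.mul_assoc]
    exact ih h

theorem adjugateSum_add_of_isGreatest (hB : B.IsHermitian)
    (hs : IsGreatest {q | minorSum q B ≠ 0} s) (i : ℕ) :
    adjugateSum (s + 1 + i) B = (-B) ^ i * adjugateSum (s + 1) B := by
  induction i with
  | zero => rw [pow_zero, one_mul, add_zero]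
  | succ i ih =>
    rw [← add_assoc, adjugateSum_succ hB, minorSum_eq_zero_of_lt hs (by omega), ih,
      Quaternion.re_zero, zero_smul, zero_sub, pow_succ', neg_mul, neg_mul, mul_assoc]

theorem mul_mul_adjugateSum_of_isGreatest (hB : B.IsHermitian)
    (hs : IsGreatest {q | minorSum q B ≠ 0} s) :
    B * B * adjugateSum s B = (minorSum s B).re • B := by
  have hpow : (-B) ^ Fintype.card ι * adjugateSum (s + 1) B = 0 := by
    rw [← adjugateSum_add_of_isGreatest hB hs, adjugateSum_eq_zero_of_card_lt (by omega)]
  have h := mul_eq_zero_of_pow_mul_eq_zero hB.neg _ hpow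
  rw [adjugateSum_succ hB, neg_mul, neg_eq_zero, mul_sub, mul_smul_comm, mul_one, sub_eq_zero,
    ← mul_assoc] at h
  exact h.symm

-- For `s` the largest order with `d_s ≠ 0`, the matrix `d_s⁻¹ • (B * adjugateSum s B)` is the
-- projection onto the range of `B`, and it has trace `s`.
theorem isGreatest_rk (hB : B.IsHermitian) : IsGreatest {q | minorSum q B ≠ 0} (rk B) := by
  obtain ⟨s, hs⟩ := exists_isGreatest_minorSum_ne_zero B
  set d := (minorSum s B).re with hd
  set C := adjugateSum s B
  have hd0 : d ≠ 0 := re_minorSum_ne_zero hB hs.1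
  have hBBC : B * B * C = d • B := mul_mul_adjugateSum_of_isGreatest hB hs
  have hBC : Commute B C := commute_adjugateSum hB s
  let E := d⁻¹ • (B * C)
  have hBE : B * E = B := by
    rw [mul_smul_comm, ← mul_assoc, hBBC, smul_smul, inv_mul_cancel₀ hd0, one_smul]
  have hEB : E = (d⁻¹ • C) * B := by rw [smul_mul_assoc, ← hBC.eq]
  have hE : IsIdempotentElem E := by
    change E * E = E
    nth_rw 1 [hEB]
    rw [mul_assoc, hBE, ← hEB]
  have hrk : rk E = rk B := by
    apply le_antisymm
    · rw [hEB]
      exact rk_mul_le_right _ B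
    · conv_lhs => rw [← hBE]
      exact rk_mul_le_right B E
  have htrace : reTrace E = s := by
    rw [reTrace_smul, reTrace_mul_adjugateSum hB, ← hd, mul_comm, mul_assoc, mul_inv_cancel₀ hd0,
      mul_one]
  rwa [← hrk, ← Nat.cast_injective (htrace.symm.trans (reTrace_of_isIdempotentElem hE))]

end RankOfHermitian

section MoorePenrose

variable {ι κ : Type*} [Fintype ι] [Fintype κ] {A : Matrix ι κ ℍ[ℝ]} {X : Matrix κ ι ℍ[ℝ]}

namespace IsMoorePenrose

theorem conjTranspose (h : IsMoorePenrose A X) : IsMoorePenrose Aᴴ Xᴴ := by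
  obtain ⟨hAXA, hXAX, hAX, hXA⟩ := h
  refine ⟨?_, ?_, ?_, ?_⟩
  · rw [← Matrix.conjTranspose_mul, ← Matrix.conjTranspose_mul, ← Matrix.mul_assoc, hAXA]
  · rw [← Matrix.conjTranspose_mul, ← Matrix.conjTranspose_mul, ← Matrix.mul_assoc, hXAX]
  · rw [← Matrix.conjTranspose_mul, hXA, hXA]
  · rw [← Matrix.conjTranspose_mul, hAX, hAX]

theorem mul_mul_conjTranspose (h : IsMoorePenrose A X) : X * (A * Aᴴ) = Aᴴ := by
  rw [← Matrix.mul_assoc, ← h.2.2.2, ← Matrix.conjTranspose_mul, ← Matrix.mul_assoc, h.1]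

theorem mul_conjTranspose_mul (h : IsMoorePenrose A X) : X * (Xᴴ * Aᴴ) = X := by
  rw [← Matrix.conjTranspose_mul, h.2.2.1, ← Matrix.mul_assoc, h.2.1]

end IsMoorePenrose

theorem isMoorePenrose_mpInv [DecidableEq κ] (A : Matrix ι κ ℍ[ℝ]) : IsMoorePenrose A (mpInv A) :=
  (existsUnique_moorePenrose A).choose_spec.1

theorem mpInv_conjTranspose [DecidableEq ι] [DecidableEq κ] (A : Matrix ι κ ℍ[ℝ]) :
    mpInv Aᴴ = (mpInv A)ᴴ :=
  ((existsUnique_moorePenrose Aᴴ).choose_spec.2 _ (isMoorePenrose_mpInv A).conjTranspose).symm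

theorem rk_conjTranspose_mul_self {ι κ : Type*} [Fintype ι] [Finite κ] (A : Matrix ι κ ℍ[ℝ]) :
    rk (Aᴴ * A) = rk A := by
  classical
  cases nonempty_fintype κ
  refine le_antisymm (rk_mul_le_right Aᴴ A) ?_
  have h := (isMoorePenrose_mpInv A).conjTranspose.mul_mul_conjTranspose
  rw [Matrix.conjTranspose_conjTranspose] at h
  conv_lhs => rw [← h]
  exact rk_mul_le_right _ _

theorem rk_self_mul_conjTranspose {ι κ : Type*} [Finite ι] [Fintype κ] (A : Matrix ι κ ℍ[ℝ]) :
    rk (A * Aᴴ) = rk A := by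
  cases nonempty_fintype ι
  rw [← rk_conjTranspose A, ← rk_conjTranspose_mul_self Aᴴ, Matrix.conjTranspose_conjTranspose]

end MoorePenrose

section SumMatrices

variable {ι μ : Type*} [Fintype ι] [LinearOrder ι]

/-- The matrix of the `rdetSum q B j` of the rows of `Y`. -/
noncomputable def rdetSumMatrix (q : ℕ) (B : Matrix ι ι ℍ[ℝ]) (Y : Matrix μ ι ℍ[ℝ]) :
    Matrix μ ι ℍ[ℝ] :=
  Matrix.of fun i j => rdetSum q B j (Y.row i)

/-- The matrix of the `cdetSum q B i` of the columns of `Y`. -/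
noncomputable def cdetSumMatrix (q : ℕ) (B : Matrix ι ι ℍ[ℝ]) (Y : Matrix ι μ ℍ[ℝ]) :
    Matrix ι μ ℍ[ℝ] :=
  Matrix.of fun i j => cdetSum q B i (Y.col j)

theorem rdetSumMatrix_eq_mul_adjugateSum (q : ℕ) (B : Matrix ι ι ℍ[ℝ])
    (Y : Matrix μ ι ℍ[ℝ]) : rdetSumMatrix q B Y = Y * adjugateSum q B :=
  Matrix.ext fun i j => rdetSum_eq_vecMul_adjugateSum q B j (Y.row i)

theorem cdetSumMatrix_eq_conjTranspose {B : Matrix ι ι ℍ[ℝ]} (hB : B.IsHermitian)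
    (q : ℕ) (Y : Matrix ι μ ℍ[ℝ]) : cdetSumMatrix q B Y = (rdetSumMatrix q B Yᴴ)ᴴ :=
  Matrix.ext fun i j => cdetSum_eq_star_rdetSum q hB i (Y.col j)

end SumMatrices

section MoorePenroseMinors

variable {ι κ μ : Type*} [Fintype ι] [Fintype κ]

theorem isGreatest_rk_mul_conjTranspose [LinearOrder ι] (A : Matrix ι κ ℍ[ℝ]) :
    IsGreatest {q | minorSum q (A * Aᴴ) ≠ 0} (rk A) :=
  rk_self_mul_conjTranspose A ▸ isGreatest_rk (Matrix.isHermitian_mul_conjTranspose_self A)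

theorem re_minorSum_rk_mul_conjTranspose_ne_zero [LinearOrder ι] (A : Matrix ι κ ℍ[ℝ]) :
    (minorSum (rk A) (A * Aᴴ)).re ≠ 0 :=
  re_minorSum_ne_zero (Matrix.isHermitian_mul_conjTranspose_self A)
    (isGreatest_rk_mul_conjTranspose A).1

theorem re_minorSum_rk_conjTranspose_mul_ne_zero [LinearOrder κ] (A : Matrix ι κ ℍ[ℝ]) :
    (minorSum (rk A) (Aᴴ * A)).re ≠ 0 := by
  simpa only [rk_conjTranspose, Matrix.conjTranspose_conjTranspose] using
    re_minorSum_rk_mul_conjTranspose_ne_zero Aᴴ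

theorem conjTranspose_mul_adjugateSum_rk [LinearOrder ι] [DecidableEq κ] (A : Matrix ι κ ℍ[ℝ]) :
    Aᴴ * adjugateSum (rk A) (A * Aᴴ) = (minorSum (rk A) (A * Aᴴ)).re • mpInv A := by
  have hB := Matrix.isHermitian_mul_conjTranspose_self A
  have hX := isMoorePenrose_mpInv A
  set X := mpInv A
  set B := A * Aᴴ with hBdef
  set C := adjugateSum (rk A) B
  set d := (minorSum (rk A) B).re
  calc Aᴴ * C = X * (B * C) := by rw [← Matrix.mul_assoc, hX.mul_mul_conjTranspose]
    _ = X * (Xᴴ * Aᴴ) * (B * C) := by rw [hX.mul_conjTranspose_mul]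
    _ = X * Xᴴ * X * (B * B * C) := by
      rw [← hX.mul_mul_conjTranspose]
      simp only [Matrix.mul_assoc, ← hBdef]
    _ = X * Xᴴ * X * (d • B) := by
      rw [mul_mul_adjugateSum_of_isGreatest hB (isGreatest_rk_mul_conjTranspose A)]
    _ = d • (X * (Xᴴ * Aᴴ)) := by
      rw [Matrix.mul_smul, Matrix.mul_assoc, hX.mul_mul_conjTranspose, Matrix.mul_assoc]
    _ = d • X := by rw [hX.mul_conjTranspose_mul]

theorem rdetSumMatrix_mul_conjTranspose [LinearOrder ι] [DecidableEq κ]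
    (A : Matrix ι κ ℍ[ℝ]) (Y : Matrix μ κ ℍ[ℝ]) :
    rdetSumMatrix (rk A) (A * Aᴴ) (Y * Aᴴ) = (minorSum (rk A) (A * Aᴴ)).re • (Y * mpInv A) := by
  rw [rdetSumMatrix_eq_mul_adjugateSum, Matrix.mul_assoc, conjTranspose_mul_adjugateSum_rk,
    Matrix.mul_smul]

theorem cdetSumMatrix_conjTranspose_mul [LinearOrder κ] (A : Matrix ι κ ℍ[ℝ])
    (Y : Matrix ι μ ℍ[ℝ]) :
    cdetSumMatrix (rk A) (Aᴴ * A) (Aᴴ * Y) = (minorSum (rk A) (Aᴴ * A)).re • (mpInv A * Y) := by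
  classical
  have h := rdetSumMatrix_mul_conjTranspose Aᴴ Yᴴ
  rw [Matrix.conjTranspose_conjTranspose, rk_conjTranspose, mpInv_conjTranspose] at h
  rw [cdetSumMatrix_eq_conjTranspose (Matrix.isHermitian_conjTranspose_mul_self A),
    Matrix.conjTranspose_mul, Matrix.conjTranspose_conjTranspose, h]
  ext1 i j
  simp [Matrix.conjTranspose_apply, Matrix.mul_apply]

end MoorePenroseMinors

section Drazin

/-- `d` is the Drazin inverse of `u`, the first equation being required for the exponent `k`. -/
structure IsDrazinInverse {M : Type*} [Monoid M] (k : ℕ) (u d : M) : Prop where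
  pow_succ_mul : u ^ (k + 1) * d = u ^ k
  mul_mul_self : d * u * d = d
  commute : Commute u d

namespace IsDrazinInverse

variable {M : Type*} [Monoid M] {k l : ℕ} {u d e p : M}

theorem mono (h : IsDrazinInverse k u d) (hkl : k ≤ l) : IsDrazinInverse l u d where
  pow_succ_mul := by
    obtain ⟨i, rfl⟩ := Nat.exists_eq_add_of_le hkl
    rw [add_assoc, add_left_comm, pow_add, mul_assoc, h.pow_succ_mul, ← pow_add, add_comm]
  mul_mul_self := h.mul_mul_self
  commute := h.commute

theorem pow_eq_pow_mul (h : IsDrazinInverse k u d) (i : ℕ) : u ^ k = u ^ (k + i) * d ^ i :=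
  pow_eq_pow_add h.pow_succ_mul.symm i

theorem pow_eq_mul_pow (h : IsDrazinInverse k u d) (i : ℕ) : u ^ k = d ^ i * u ^ (k + i) := by
  rw [← (h.commute.pow_pow _ _).eq, ← h.pow_eq_pow_mul]

theorem pow_mul_pow_succ (h : IsDrazinInverse k u d) (i : ℕ) : u ^ i * d ^ (i + 1) = d := by
  induction i with
  | zero => rw [pow_zero, one_mul, zero_add, pow_one]
  | succ i ih =>
    calc u ^ (i + 1) * d ^ (i + 2) = u ^ i * (u * d * d) * d ^ i := by
          rw [pow_succ u, pow_succ' d, pow_succ' d]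
          simp only [mul_assoc]
      _ = u ^ i * d ^ (i + 1) := by
          rw [h.commute.eq, h.mul_mul_self, mul_assoc, ← pow_succ']
      _ = d := ih

theorem unique (hd : IsDrazinInverse k u d) (he : IsDrazinInverse l u e) : d = e := by
  replace hd := hd.mono (le_max_left k l)
  replace he := he.mono (le_max_right k l)
  set n := max k l
  calc d = d ^ (n + 1) * u ^ n := by
        rw [← (hd.commute.pow_pow _ _).eq, hd.pow_mul_pow_succ]
    _ = d ^ (n + 1) * u ^ n * (u * e) := by
        rw [mul_assoc, ← mul_assoc (u ^ n), ← pow_succ, he.pow_succ_mul]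
    _ = d * u ^ 1 * e := by
        rw [← (hd.commute.pow_pow _ _).eq, hd.pow_mul_pow_succ, pow_one, mul_assoc]
    _ = d ^ 1 * u ^ (n + 1) * e ^ (n + 1) := by
        rw [pow_one, pow_one, pow_succ', ← mul_assoc, mul_assoc _ _ (e ^ _), he.pow_mul_pow_succ]
    _ = e := by rw [← hd.pow_eq_mul_pow, he.pow_mul_pow_succ]

theorem pow_mul_mul_pow (h : IsDrazinInverse k u d)
    (hp : u ^ (2 * k + 1) * p * u ^ (2 * k + 1) = u ^ (2 * k + 1)) : u ^ k * p * u ^ k = d := by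
  have hk : 2 * k + 1 = k + (k + 1) := by omega
  rw [hk] at hp
  calc u ^ k * p * u ^ k
      = d ^ (k + 1) * u ^ (k + (k + 1)) * p * (u ^ (k + (k + 1)) * d ^ (k + 1)) := by
        rw [← h.pow_eq_mul_pow, ← h.pow_eq_pow_mul]
    _ = d ^ (k + 1) * (u ^ (k + (k + 1)) * p * u ^ (k + (k + 1))) * d ^ (k + 1) := by
        simp only [mul_assoc]
    _ = d := by rw [hp, ← h.pow_eq_mul_pow, h.pow_mul_pow_succ]

theorem pow_succ_mul_pow_mul_pow_succ (h : IsDrazinInverse k u d)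
    (hp : u ^ (2 * k + 1) * p * u ^ (2 * k + 1) = u ^ (2 * k + 1)) :
    u ^ (k + 1) * p * u ^ (2 * k) * p * u ^ (k + 1) = u * d := by
  calc u ^ (k + 1) * p * u ^ (2 * k) * p * u ^ (k + 1)
      = u * (u ^ k * p * u ^ k) * (u ^ k * p * u ^ k) * u := by
        rw [two_mul, pow_add u k k]
        nth_rw 1 [pow_succ']
        rw [pow_succ]
        simp only [mul_assoc]
    _ = u * (d * d * u) := by rw [h.pow_mul_mul_pow hp]; simp only [mul_assoc]
    _ = u * d := by rw [mul_assoc d d, ← h.commute.eq, ← mul_assoc d u, h.mul_mul_self]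

end IsDrazinInverse

variable {ι κ : Type*} [Fintype ι] [DecidableEq ι] [Fintype κ]

theorem exists_isDrazinInverse (U : Matrix ι ι ℍ[ℝ]) : ∃ D, IsDrazinInverse (ind U) U D :=
  let ⟨D, h₁, h₂, h₃⟩ := exists_drazin U
  ⟨D, h₁, h₂, h₃⟩

theorem rk_pow_add {U : Matrix ι ι ℍ[ℝ]} {k : ℕ} (hk : ind U ≤ k) (i : ℕ) :
    rk (U ^ (k + i)) = rk (U ^ k) := by
  obtain ⟨D, hD⟩ := exists_isDrazinInverse U
  apply le_antisymm
  · rw [add_comm, pow_add]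
    exact rk_mul_le_right _ _
  · conv_lhs => rw [(hD.mono hk).pow_eq_mul_pow i]
    exact rk_mul_le_right _ _

theorem rk_pow_two_mul_add_one {U : Matrix ι ι ℍ[ℝ]} {k : ℕ} (hk : ind U ≤ k) :
    rk (U ^ (2 * k + 1)) = rk (U ^ k) := by
  rw [two_mul, add_assoc, rk_pow_add hk]

theorem mul_pow_mul_comm [DecidableEq κ] (A : Matrix ι κ ℍ[ℝ]) (W : Matrix κ ι ℍ[ℝ]) (n : ℕ) :
    (W * A) ^ n * W = W * (A * W) ^ n := by
  induction n with
  | zero => rw [pow_zero, pow_zero, Matrix.one_mul, Matrix.mul_one]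
  | succ n ih =>
    rw [pow_succ', pow_succ', Matrix.mul_assoc (W * A), ih]
    simp only [Matrix.mul_assoc]

theorem isWDrazin_wDrazin (A : Matrix ι κ ℍ[ℝ]) (W : Matrix κ ι ℍ[ℝ]) :
    IsWDrazin A W (wDrazin A W) :=
  (existsUnique_wDrazin A W).choose_spec.1

theorem isDrazinInverse_wDrazin_mul (A : Matrix ι κ ℍ[ℝ]) (W : Matrix κ ι ℍ[ℝ]) :
    IsDrazinInverse (ind (A * W)) (A * W) (wDrazin A W * W) := by
  obtain ⟨h₁, h₂, h₃⟩ := isWDrazin_wDrazin A W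
  refine ⟨by rw [← Matrix.mul_assoc, h₁], ?_, ?_⟩
  · conv_rhs => rw [← h₂]
    simp only [Matrix.mul_assoc]
  · change A * W * (wDrazin A W * W) = wDrazin A W * W * (A * W)
    rw [← Matrix.mul_assoc, h₃]
    simp only [Matrix.mul_assoc]

theorem isDrazinInverse_mul_wDrazin [DecidableEq κ] (A : Matrix ι κ ℍ[ℝ]) (W : Matrix κ ι ℍ[ℝ])
    {k : ℕ} (hk : ind (W * A) ≤ k) : IsDrazinInverse k (W * A) (W * wDrazin A W) := by
  obtain ⟨h₁, h₂, h₃⟩ := isWDrazin_wDrazin A W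
  set X := wDrazin A W
  have hWX : IsDrazinInverse (ind (A * W) + 1) (W * A) (W * X) := by
    refine ⟨?_, ?_, ?_⟩
    · calc (W * A) ^ (ind (A * W) + 1 + 1) * (W * X)
          = W * ((A * W) ^ (ind (A * W) + 1) * (A * W * X)) := by
            rw [← Matrix.mul_assoc, mul_pow_mul_comm, pow_succ]
            simp only [Matrix.mul_assoc]
        _ = W * ((A * W) ^ (ind (A * W) + 1) * X * W * A) := by
            rw [h₃]
            simp only [Matrix.mul_assoc]
        _ = (W * A) ^ (ind (A * W) + 1) := by
            rw [h₁, pow_succ, ← Matrix.mul_assoc, ← Matrix.mul_assoc, mul_pow_mul_comm]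
    · calc W * X * (W * A) * (W * X) = W * (X * W * A * W * X) := by
            simp only [Matrix.mul_assoc]
        _ = W * X := by rw [h₂]
    · calc W * A * (W * X) = W * (A * W * X) := by simp only [Matrix.mul_assoc]
        _ = W * X * (W * A) := by rw [h₃]; simp only [Matrix.mul_assoc]
  obtain ⟨D, hD⟩ := exists_isDrazinInverse (W * A)
  exact hWX.unique hD ▸ hD.mono hk

end Drazin

section WeightedCMP

variable {ι κ : Type*} [Fintype ι] [LinearOrder ι] [Fintype κ] [LinearOrder κ]
  {A : Matrix ι κ ℍ[ℝ]} {W : Matrix κ ι ℍ[ℝ]} {k : ℕ}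

theorem wCMP_eq_of_ind_mul_left_le (hk : ind (W * A) ≤ k) :
    let U := W * A
    let P := mpInv (U ^ (2 * k + 1))
    wCMP A W = mpInv A * A * (U ^ (k + 1) * P * U ^ (2 * k) * P * U ^ (k + 1)) * mpInv A := by
  intro U P
  have h := (isDrazinInverse_mul_wDrazin A W hk).pow_succ_mul_pow_mul_pow_succ
    (isMoorePenrose_mpInv _).1
  rw [h, (isDrazinInverse_mul_wDrazin A W hk).commute.eq, wCMP]
  simp only [Matrix.mul_assoc]

theorem wCMP_eq_of_ind_mul_right_le (hk : ind (A * W) ≤ k) :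
    let V := A * W
    let P := mpInv (V ^ (2 * k + 1))
    wCMP A W = mpInv A * (V ^ (k + 1) * P * V ^ (2 * k) * P * V ^ (k + 1)) * A * mpInv A := by
  intro V P
  have h := ((isDrazinInverse_wDrazin_mul A W).mono hk).pow_succ_mul_pow_mul_pow_succ
    (isMoorePenrose_mpInv _).1
  rw [h, wCMP]
  simp only [Matrix.mul_assoc]

/-- The matrix `Ω̃` of the paper, whose rows enter the row-determinantal representation of
`A^{c,†,W}`; `Φ`, `Φh` and `Ω` are the auxiliary matrices `Φ`, `Φ̂` and `Ω`. -/
noncomputable def omegaTilde (A : Matrix ι κ ℍ[ℝ]) (W : Matrix κ ι ℍ[ℝ]) (k : ℕ) :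
    Matrix κ ι ℍ[ℝ] :=
  let U := W * A
  let M := U ^ (2 * k + 1)
  let Φ := rdetSumMatrix (rk (U ^ k)) (M * Mᴴ) (U ^ k * Mᴴ)
  let Φh := rdetSumMatrix (rk (U ^ k)) (M * Mᴴ) (A * Φ * U ^ (2 * k) * Mᴴ)
  let Ω := cdetSumMatrix (rk A) (Aᴴ * A) (Aᴴ * A * W * Φh)
  Ω * U ^ (k + 1) * Aᴴ

/-- The matrix `Υ̃` of the paper, whose columns enter the column-determinantal representation of
`A^{c,†,W}`; `Ψ`, `Ψh` and `Υ` are the auxiliary matrices `Ψ`, `Ψ̂` and `Υ`. -/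
noncomputable def upsilonTilde (A : Matrix ι κ ℍ[ℝ]) (W : Matrix κ ι ℍ[ℝ]) (k : ℕ) :
    Matrix κ ι ℍ[ℝ] :=
  let V := A * W
  let M := V ^ (2 * k + 1)
  let Ψ := cdetSumMatrix (rk (V ^ k)) (Mᴴ * M) (Mᴴ * V ^ k)
  let Ψh := cdetSumMatrix (rk (V ^ k)) (Mᴴ * M) (Mᴴ * V ^ (2 * k) * Ψ * A)
  let Υ := rdetSumMatrix (rk A) (A * Aᴴ) (Ψh * W * A * Aᴴ)
  Aᴴ * V ^ (k + 1) * Υ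

theorem rdetSumMatrix_omegaTilde (hk : ind (W * A) ≤ k) :
    let M := (W * A) ^ (2 * k + 1)
    rdetSumMatrix (rk A) (A * Aᴴ) (omegaTilde A W k) =
      ((minorSum (rk A) (Aᴴ * A)).re ^ 2 *
        (minorSum (rk ((W * A) ^ k)) (M * Mᴴ)).re ^ 2) • wCMP A W := by
  intro M
  simp only [omegaTilde, ← rk_pow_two_mul_add_one hk]
  rw [rdetSumMatrix_mul_conjTranspose A, rdetSumMatrix_mul_conjTranspose M,
    rdetSumMatrix_mul_conjTranspose M, Matrix.mul_assoc Aᴴ A, Matrix.mul_assoc Aᴴ,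
    cdetSumMatrix_conjTranspose_mul A, minorSum_mul_conjTranspose A,
    wCMP_eq_of_ind_mul_left_le hk]
  simp only [Matrix.mul_smul, Matrix.smul_mul, smul_smul]
  congr 1
  · ring
  · rw [pow_succ']
    simp only [Matrix.mul_assoc, M]

theorem cdetSumMatrix_upsilonTilde (hk : ind (A * W) ≤ k) :
    let M := (A * W) ^ (2 * k + 1)
    cdetSumMatrix (rk A) (Aᴴ * A) (upsilonTilde A W k) =
      ((minorSum (rk A) (A * Aᴴ)).re ^ 2 *
        (minorSum (rk ((A * W) ^ k)) (Mᴴ * M)).re ^ 2) • wCMP A W := by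
  intro M
  simp only [upsilonTilde, ← rk_pow_two_mul_add_one hk]
  rw [Matrix.mul_assoc Aᴴ, cdetSumMatrix_conjTranspose_mul A, rdetSumMatrix_mul_conjTranspose A,
    Matrix.mul_assoc Mᴴ, Matrix.mul_assoc Mᴴ, cdetSumMatrix_conjTranspose_mul M,
    cdetSumMatrix_conjTranspose_mul M, minorSum_mul_conjTranspose A,
    wCMP_eq_of_ind_mul_right_le hk]
  simp only [Matrix.mul_smul, Matrix.smul_mul, smul_smul]
  congr 1
  · ring
  · rw [pow_succ (A * W) k]
    simp only [Matrix.mul_assoc, M]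

theorem eq_div_of_eq_smul {a b : ℝ} (ha : a ≠ 0) (hb : b ≠ 0) {x y : ℍ[ℝ]}
    (h : y = (a ^ 2 * b ^ 2) • x) : x = y / ((a : ℍ[ℝ]) ^ 2 * (b : ℍ[ℝ]) ^ 2) := by
  have hab : (a : ℍ[ℝ]) ^ 2 * (b : ℍ[ℝ]) ^ 2 = ((a ^ 2 * b ^ 2 : ℝ) : ℍ[ℝ]) := by push_cast; rfl
  have h0 : (a : ℍ[ℝ]) ^ 2 * (b : ℍ[ℝ]) ^ 2 ≠ 0 := by
    rw [hab]
    exact fun h => (by positivity : a ^ 2 * b ^ 2 ≠ 0) (Quaternion.coe_injective h)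
  rw [eq_div_iff h0, hab, h, Quaternion.mul_coe_eq_smul]

theorem theorem5p3_general (A : Matrix ι κ ℍ[ℝ]) (W : Matrix κ ι ℍ[ℝ]) (k : ℕ) :
    (ind (W * A) ≤ k →
      let U := W * A
      let G := U ^ (2 * k + 1) * (U ^ (2 * k + 1))ᴴ
      ∀ i j, wCMP A W i j = rdetSum (rk A) (A * Aᴴ) j ((omegaTilde A W k).row i) /
        ((minorSum (rk A) (Aᴴ * A)) ^ 2 * (minorSum (rk (U ^ k)) G) ^ 2)) ∧
    (ind (A * W) ≤ k →
      let V := A * W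
      let H := (V ^ (2 * k + 1))ᴴ * V ^ (2 * k + 1)
      ∀ i j, wCMP A W i j = cdetSum (rk A) (Aᴴ * A) i ((upsilonTilde A W k).col j) /
        ((minorSum (rk A) (A * Aᴴ)) ^ 2 * (minorSum (rk (V ^ k)) H) ^ 2)) := by
  refine ⟨fun hk => ?_, fun hk => ?_⟩
  · intro U G i j
    rw [minorSum_eq_coe_re (Matrix.isHermitian_conjTranspose_mul_self A),
      minorSum_eq_coe_re (Matrix.isHermitian_mul_conjTranspose_self _)]
    refine eq_div_of_eq_smul (re_minorSum_rk_conjTranspose_mul_ne_zero A) ?_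
      (congrFun₂ (rdetSumMatrix_omegaTilde hk) i j)
    rw [← rk_pow_two_mul_add_one hk]
    exact re_minorSum_rk_mul_conjTranspose_ne_zero _
  · intro V H i j
    rw [minorSum_eq_coe_re (Matrix.isHermitian_mul_conjTranspose_self A),
      minorSum_eq_coe_re (Matrix.isHermitian_conjTranspose_mul_self _)]
    refine eq_div_of_eq_smul (re_minorSum_rk_mul_conjTranspose_ne_zero A) ?_
      (congrFun₂ (cdetSumMatrix_upsilonTilde hk) i j)
    rw [← rk_pow_two_mul_add_one hk]
    exact re_minorSum_rk_conjTranspose_mul_ne_zero _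

end WeightedCMP

end QuatMat

theorem theorem5p3 (m n : ℕ) (A : Matrix (Fin m) (Fin n) ℍ[ℝ]) (W : Matrix (Fin n) (Fin m) ℍ[ℝ])
    (hW : W ≠ 0) (r r₁ k : ℕ) (hr : rk A = r) (hk : k = max (ind (W * A)) (ind (A * W))) :
    (rk ((W * A) ^ k) = r₁ →
      let U : Matrix (Fin n) (Fin n) ℍ[ℝ] := W * A
      let G : Matrix (Fin n) (Fin n) ℍ[ℝ] := U ^ (2 * k + 1) * (U ^ (2 * k + 1))ᴴ
      let Uc : Matrix (Fin n) (Fin n) ℍ[ℝ] := U ^ k * (U ^ (2 * k + 1))ᴴ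
      let Φ : Matrix (Fin n) (Fin n) ℍ[ℝ] := Matrix.of fun l q => rdetSum r₁ G q (Uc.row l)
      let Φt : Matrix (Fin m) (Fin n) ℍ[ℝ] := A * Φ * U ^ (2 * k) * (U ^ (2 * k + 1))ᴴ
      let Φh : Matrix (Fin m) (Fin n) ℍ[ℝ] := Matrix.of fun t z => rdetSum r₁ G z (Φt.row t)
      let Φ₁ : Matrix (Fin n) (Fin n) ℍ[ℝ] := Aᴴ * A * W * Φh
      let Ω : Matrix (Fin n) (Fin n) ℍ[ℝ] := Matrix.of fun i z => cdetSum r (Aᴴ * A) i (Φ₁.col z)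
      let Ωt : Matrix (Fin n) (Fin m) ℍ[ℝ] := Ω * (W * A) ^ (k + 1) * Aᴴ
      ∀ (i : Fin n) (j : Fin m),
        wCMP A W i j = rdetSum r (A * Aᴴ) j (Ωt.row i) /
          ((minorSum r (Aᴴ * A)) ^ 2 * (minorSum r₁ G) ^ 2)) ∧
    (rk ((A * W) ^ k) = r₁ →
      let V : Matrix (Fin m) (Fin m) ℍ[ℝ] := A * W
      let H : Matrix (Fin m) (Fin m) ℍ[ℝ] := (V ^ (2 * k + 1))ᴴ * V ^ (2 * k + 1)
      let Vh : Matrix (Fin m) (Fin m) ℍ[ℝ] := (V ^ (2 * k + 1))ᴴ * V ^ k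
      let Ψ : Matrix (Fin m) (Fin m) ℍ[ℝ] := Matrix.of fun l t => cdetSum r₁ H l (Vh.col t)
      let Ψt : Matrix (Fin m) (Fin n) ℍ[ℝ] := (V ^ (2 * k + 1))ᴴ * V ^ (2 * k) * Ψ * A
      let Ψh : Matrix (Fin m) (Fin n) ℍ[ℝ] := Matrix.of fun z s => cdetSum r₁ H z (Ψt.col s)
      let Ψ₁ : Matrix (Fin m) (Fin m) ℍ[ℝ] := Ψh * W * A * Aᴴ
      let Υ : Matrix (Fin m) (Fin m) ℍ[ℝ] := Matrix.of fun z j => rdetSum r (A * Aᴴ) j (Ψ₁.row z)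
      let Υt : Matrix (Fin n) (Fin m) ℍ[ℝ] := Aᴴ * (A * W) ^ (k + 1) * Υ
      ∀ (i : Fin n) (j : Fin m),
        wCMP A W i j = cdetSum r (Aᴴ * A) i (Υt.col j) /
          ((minorSum r (A * Aᴴ)) ^ 2 * (minorSum r₁ H) ^ 2)) := by
  subst hr hk
  refine ⟨?_, ?_⟩ <;> rintro rfl
  · exact (theorem5p3_general A W _).1 (le_max_left _ _)
  · exact (theorem5p3_general A W _).2 (le_max_right _ _)
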